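/- Let $u,v$ be integers with $v\ge u\ge 9$, let $\tau_1=[\overline{u,v}]=u+\cfrac{1}{v+\cfrac{1}{u+\cdots}}$ and $\tau_2=[\overline{v,u}]$, and let $\varphi=(1+\sqrt5)/2$. For a real quadratic irrational number $x$ let $x^{\sigma}$ denote its Galois conjugate over $\mathbb{Q}$. For a real quadratic irrational number $\alpha$ let $\Theta_\alpha=PSL(2,\mathbb{Z})\{\alpha,\alpha^\sigma\}$ be the union of the orbits of $\alpha$ and $\alpha^\sigma$ under fractional linear transformations, and for a real number $\xi\notin\mathbb{Q}\cup\Theta_\alpha$ put $$c_\alpha(\xi)=\liminf_{\beta\in\Theta_\alpha,\ |\beta-\beta^\sigma|\to0}2\,\frac{|\xi-\beta|}{|\beta-\beta^\sigma|}.$$ Let $Sp_\alpha=\{c_\alpha(\xi):\xi\in\mathbb{R}\setminus(\mathbb{Q}\cup\Theta_\alpha)\}$ be the quadratic Lagrange spectrum of $\alpha$; its maximum $K_\alpha$ is called the Hurwitz constant of $\alpha$. Then, for $\beta_{u,v}=[\overline{u,v}]$, the maximum of $Sp_{\beta_{u,v}}$ exists and $$K_{\beta_{u,v}}=\frac{2(\tau_1-\varphi^2)\left(1+\frac{\tau_2}{\varphi^2}\right)}{\left(\varphi+\frac1\varphi\right)(\tau_1\tau_2+1)}.$$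 Moreover $\varphi\notin\mathbb{Q}\cup\Theta_{\tau_1}$ and $K_{\beta_{u,v}}=c_{\tau_1}(\varphi)$, so the maximum is attained at $\varphi$. -/

import Mathlib

open Filter Topology

noncomputable section

/-- The finite continued fraction `[a₀, a₁, …, aₙ] = a₀ + 1 / (a₁ + 1 / (⋯ + 1 / aₙ))`. -/
def finCF (a : ℕ → ℕ) : ℕ → ℝ
  | 0 => (a 0 : ℝ)
  | n + 1 => (a 0 : ℝ) + 1 / finCF (fun k => a (k + 1)) n

/-- The infinite continued fraction `[a₀, a₁, a₂, …]`: the limit of the finite ones. -/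
def infCF (a : ℕ → ℕ) : ℝ := limUnder atTop (finCF a)

/-- The sequence `u, v, u, v, …`. -/
def altSeq (u v : ℕ) (n : ℕ) : ℕ := if Even n then u else v

/-- The purely periodic continued fraction `[u, v, u, v, …]`. -/
def betaCF (u v : ℕ) : ℝ := infCF (altSeq u v)

/-- The Galois conjugate over `ℚ` of a real quadratic irrational number `x`: the other root of its
minimal polynomial `X ^ 2 + b * X + c`, that is `-b - x`. -/
def galConj (x : ℝ) : ℝ := -(((minpoly ℚ x).coeff 1 : ℚ) : ℝ) - x

/-- The fractional linear action of `SL(2, ℤ)` (equivalently of `PSL(2, ℤ)`) on irrational reals. -/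
def moebius (g : Matrix.SpecialLinearGroup (Fin 2) ℤ) (x : ℝ) : ℝ :=
  ((g 0 0 : ℝ) * x + (g 0 1 : ℝ)) / ((g 1 0 : ℝ) * x + (g 1 1 : ℝ))

/-- `Θ_α`, the union of the `PSL(2, ℤ)`-orbits of `α` and of its Galois conjugate. -/
def orbitTheta (α : ℝ) : Set ℝ :=
  {β | ∃ g : Matrix.SpecialLinearGroup (Fin 2) ℤ, β = moebius g α ∨ β = moebius g (galConj α)}

/-- The lower limit `c_α(ξ)` of `2 |ξ - β| / |β - β^σ|` over `β ∈ Θ_α`, `|β - β^σ| → 0`, taken in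
the extended reals so that no boundedness is presupposed. -/
def approxConst (α ξ : ℝ) : EReal :=
  liminf (fun β : ℝ => ((2 * (|ξ - β| / |β - galConj β|) : ℝ) : EReal))
    (comap (fun β : ℝ => |β - galConj β|) (𝓝 0) ⊓ 𝓟 (orbitTheta α))

/-- The quadratic Lagrange spectrum `Sp_α`: all `c_α(ξ)`, for real `ξ` not in `ℚ ∪ Θ_α`. -/
def quadLagrangeSpectrum (α : ℝ) : Set EReal :=
  {c | ∃ ξ : ℝ, Irrational ξ ∧ ξ ∉ orbitTheta α ∧ approxConst α ξ = c}

/-- `K` is the Hurwitz constant of `α`: the maximum of `Sp_α`. -/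
def IsHurwitzConstant (α K : ℝ) : Prop := IsGreatest (quadLagrangeSpectrum α) (K : EReal)

/-- For a quadratic number `x`, `galConj x` is indeed the other root of the minimal polynomial. -/
theorem minpoly_eq_mul_galConj (x : ℝ) (hx : (minpoly ℚ x).natDegree = 2) :
    (minpoly ℚ x).map (algebraMap ℚ ℝ) =
      (Polynomial.X - Polynomial.C x) * (Polynomial.X - Polynomial.C (galConj x)) := by
  have hint : IsIntegral ℚ x := by
    by_contra h
    rw [minpoly.eq_zero h] at hx
    simp at hx
  have hmon := minpoly.monic hint
  have h2 : (minpoly ℚ x).coeff 2 = 1 := by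
    have := hmon.coeff_natDegree
    rwa [hx] at this
  have hroot := minpoly.aeval ℚ x
  rw [Polynomial.aeval_eq_sum_range, hx] at hroot
  simp only [Finset.sum_range_succ, Finset.sum_range_zero, h2, Algebra.smul_def] at hroot
  simp at hroot
  have hform : minpoly ℚ x = Polynomial.X ^ 2 + Polynomial.C ((minpoly ℚ x).coeff 1) *
      Polynomial.X + Polynomial.C ((minpoly ℚ x).coeff 0) := by
    conv_lhs => rw [Polynomial.as_sum_range_C_mul_X_pow (minpoly ℚ x), hx]
    simp only [Finset.sum_range_succ, Finset.sum_range_zero, h2]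
    simp
    ring
  have h0 : ((minpoly ℚ x).coeff 0 : ℝ) = x * galConj x := by
    unfold galConj
    linear_combination hroot
  rw [hform]
  simp only [Polynomial.map_add, Polynomial.map_mul, Polynomial.map_pow, Polynomial.map_X,
    Polynomial.map_C]
  simp only [eq_ratCast, h0]
  have h1 : ((minpoly ℚ x).coeff 1 : ℝ) = -x - galConj x := by
    unfold galConj
    ring
  rw [h1]
  simp only [map_sub, map_neg, map_mul]
  ring

/-- The continued fraction `[u, v, u, v, …]` with positive `u`, `v` converges. -/
theorem tendsto_betaCF (u v : ℕ) (hu : 1 ≤ u) (hv : 1 ≤ v) :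
    Tendsto (finCF (altSeq u v)) atTop (𝓝 (betaCF u v)) := by
  refine tendsto_nhds_limUnder ?_
  have hs : ∀ u v : ℕ, (fun k => altSeq u v (k + 1)) = altSeq v u := by
    intro u v
    funext k
    simp only [altSeq, Nat.even_add_one]
    by_cases h : Even k <;> simp [h]
  have hrec : ∀ u v n : ℕ, finCF (altSeq u v) (n + 1) = u + 1 / finCF (altSeq v u) n := by
    intro u v n
    rw [finCF, hs]
    simp [altSeq]
  have hone : ∀ n u v : ℕ, 1 ≤ u → 1 ≤ v → 1 ≤ finCF (altSeq u v) n := by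
    intro n
    induction n with
    | zero =>
      intro u v hu hv
      simpa [finCF, altSeq] using hu
    | succ n ih =>
      intro u v hu hv
      rw [hrec]
      have h1 := ih v u hv hu
      have h2 : (0 : ℝ) ≤ 1 / finCF (altSeq v u) n := by positivity
      have h3 : (1 : ℝ) ≤ u := by exact_mod_cast hu
      linarith
  have hu' : (1 : ℝ) ≤ u := by exact_mod_cast hu
  have hv' : (1 : ℝ) ≤ v := by exact_mod_cast hv
  obtain ⟨x, y, hx, hy, hxy, hyx⟩ : ∃ x y : ℝ, 1 < x ∧ 1 < y ∧ x = u + 1 / y ∧ y = v + 1 / x := by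
    set s := Real.sqrt ((u : ℝ) ^ 2 * v ^ 2 + 4 * u * v) with hsdef
    have hs2 : s ^ 2 = (u : ℝ) ^ 2 * v ^ 2 + 4 * u * v := Real.sq_sqrt (by positivity)
    have hs0 : 0 ≤ s := Real.sqrt_nonneg _
    have hsgt : (u : ℝ) * v < s := by
      rw [hsdef]
      apply Real.lt_sqrt_of_sq_lt
      nlinarith [mul_pos (lt_of_lt_of_le one_pos hu') (lt_of_lt_of_le one_pos hv')]
    have hvx : ((u : ℝ) * v + s) / (2 * v) > u := by
      rw [gt_iff_lt, lt_div_iff₀ (by positivity)]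
      nlinarith
    have hvy : ((u : ℝ) * v + s) / (2 * u) > v := by
      rw [gt_iff_lt, lt_div_iff₀ (by positivity)]
      nlinarith
    have hp : (u : ℝ) * v + s ≠ 0 := by positivity
    refine ⟨((u : ℝ) * v + s) / (2 * v), ((u : ℝ) * v + s) / (2 * u), by linarith, by linarith,
      ?_, ?_⟩
    · field_simp
      linear_combination hs2
    · field_simp
      linear_combination hs2
  set q := max (1 / x) (1 / y) with hq
  have hq0 : 0 ≤ q := le_max_of_le_left (by positivity)
  have hq1 : q < 1 := by
    rw [hq, max_lt_iff]
    exact ⟨by rw [div_lt_one (by linarith)]; exact hx, by rw [div_lt_one (by linarith)]; exact hy⟩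
  have hstep : ∀ c z : ℝ, 1 ≤ c → 1 < z → 1 / z ≤ q → |1 / c - 1 / z| ≤ q * |c - z| := by
    intro c z hc hz hzq
    have e : 1 / c - 1 / z = -((1 / c) * (1 / z) * (c - z)) := by
      field_simp
      ring
    rw [e, abs_neg, abs_mul, abs_of_nonneg (by positivity : (0 : ℝ) ≤ 1 / c * (1 / z))]
    apply mul_le_mul_of_nonneg_right _ (abs_nonneg _)
    have : 1 / c ≤ 1 := by rw [div_le_one (by linarith)]; exact hc
    calc 1 / c * (1 / z) ≤ 1 * (1 / z) := by gcongr
      _ ≤ q := by linarith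
  set E := max |(u : ℝ) - x| |(v : ℝ) - y| with hE
  have hbound : ∀ n, |finCF (altSeq u v) n - x| ≤ q ^ n * E ∧
      |finCF (altSeq v u) n - y| ≤ q ^ n * E := by
    intro n
    induction n with
    | zero => simp [finCF, altSeq, hE]
    | succ n ih =>
      constructor
      · have h1 := hstep _ y (hone n v u hv hu) hy (le_max_right _ _)
        have h2 : finCF (altSeq u v) (n + 1) - x = 1 / finCF (altSeq v u) n - 1 / y := by
          rw [hrec]
          linarith
        rw [h2, pow_succ]
        nlinarith [mul_le_mul_of_nonneg_left ih.2 hq0]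
      · have h1 := hstep _ x (hone n u v hu hv) hx (le_max_left _ _)
        have h2 : finCF (altSeq v u) (n + 1) - y = 1 / finCF (altSeq u v) n - 1 / x := by
          rw [hrec]
          linarith
        rw [h2, pow_succ]
        nlinarith [mul_le_mul_of_nonneg_left ih.1 hq0]
  refine ⟨x, ?_⟩
  rw [tendsto_iff_norm_sub_tendsto_zero]
  refine squeeze_zero (fun n => norm_nonneg _) (fun n => (hbound n).1) ?_
  simpa using (tendsto_pow_atTop_nhds_zero_of_lt_one hq0 hq1).mul_const E

end

/-! Write x = [u,v,u,…] and y = [v,u,v,…]. The conjugate of x is x' = -1/y = u - x, so Θ is a single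
GL(2,ℤ)-orbit, and the problem concerns the images (β, β') of (x, x') under GL(2,ℤ).

Lower bound at φ, with conjugate ψ. Put T = √5·v(x - x'), the geometric mean of the discriminants of
vX² - uvXY - uY² and a form of discriminant 5, up to taking roots: T² is their product. Then
2|β-φ||β'-ψ|/|β-β'| = √5·|J ± T|/T, where J is the integral joint invariant of the first form and of
the transported form X² - XY - Y². A descent (`pairing_gap`) shows that |J| avoids an open interval
containing T. Its upper end is exactly (1+K)T, and its lower end is at least KT below T. So the
ratio is at least K√5; near φ the factor |β'-ψ| tends to √5, which leaves c(φ) ≥ K.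

Upper bound for every ξ. The matrix of the n-th convergents carries a complete quotient X to ξ and
-η to ∞, where η is a quotient of denominators. The ratio of an image of (b, b') becomes
2|X-b||b'+η|/((X+η)|b-b'|), so it suffices to find suitable explicit pairs for infinitely many n. If
X ≥ 3 infinitely often, or X < 3 eventually but X ≥ 2 infinitely often, such a pair achieves K.
Otherwise all late partial quotients are 1, X = φ, η → 1/φ, and the pair (2+1/y, 2-x) gives K in the
limit. -/

/-! ### The gap in the values of the joint invariant. -/

/-- Reducedness makes the term u v q dominate once q ≥ 5, so only q = 1 and q = 3 are critical. Both
bounds are sharp: (p,q,r) = (-1,3,-1) gives the upper one, (-1,1,1) the lower one. -/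
theorem pairing_gap_of_reduced {u v p q r : ℤ} (hu : 9 ≤ u) (huv : u ≤ v) (hq : 0 < q)
    (hdisc : q ^ 2 - 4 * p * r = 5) (hp : 0 ≤ p * (p * u + q)) (hr : 0 ≤ r * (r * v - q)) :
    3 * u * v - 2 * v + 2 * u ≤ |u * v * q + 2 * r * v - 2 * p * u| ∨
      |u * v * q + 2 * r * v - 2 * p * u| ≤ u * v + 2 * u + 2 * v := by
  have huv9 : 9 * u ≤ u * v := by nlinarith
  have hvu9 : 9 * v ≤ u * v := by nlinarith
  have hodd : q % 2 = 1 := by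
    rcases Int.emod_two_eq_zero_or_one q with h | h
    · obtain ⟨k, rfl⟩ := Int.dvd_of_emod_eq_zero h
      ring_nf at hdisc
      omega
    · exact h
  rcases (by omega : q = 1 ∨ q = 3 ∨ q = 5 ∨ 7 ≤ q) with rfl | rfl | rfl | h7
  · right
    have h1 : p * -r = 1 := by linarith
    rcases Int.mul_eq_one_iff_eq_one_or_neg_one.mp h1 with ⟨h, h'⟩ | ⟨h, h'⟩
    · obtain rfl : r = -1 := by linarith
      subst h
      rw [abs_le]; constructor <;> linarith
    · obtain rfl : r = 1 := by linarith
      subst h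
      rw [abs_le]; constructor <;> linarith
  · left
    have h1 : p * r = 1 := by linarith
    apply le_trans _ (le_abs_self _)
    rcases Int.mul_eq_one_iff_eq_one_or_neg_one.mp h1 with ⟨rfl, rfl⟩ | ⟨rfl, rfl⟩ <;> linarith
  · left
    have h1 : p * r = 5 := by linarith
    apply le_trans _ (le_abs_self _)
    have hdvd : p ∣ 5 := ⟨r, h1.symm⟩
    have hle := Int.le_of_dvd (by norm_num) hdvd
    have hge := Int.le_of_dvd (by norm_num) (neg_dvd.mpr hdvd)
    have hp5 : p = 1 ∨ p = 5 ∨ p = -1 ∨ p = -5 := by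
      rcases (by omega : p = -5 ∨ p = -4 ∨ p = -3 ∨ p = -2 ∨ p = -1 ∨ p = 0 ∨ p = 1 ∨ p = 2 ∨
        p = 3 ∨ p = 4 ∨ p = 5) with h | h | h | h | h | h | h | h | h | h | h <;> subst h <;> omega
    rcases hp5 with rfl | rfl | rfl | rfl
    · obtain rfl : r = 5 := by linarith
      linarith
    · obtain rfl : r = 1 := by linarith
      linarith
    · obtain rfl : r = -5 := by linarith
      linarith
    · obtain rfl : r = -1 := by linarith
      linarith
  · left
    apply le_trans _ (le_abs_self _)
    have hpr : 0 < p * r := by nlinarith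
    have hquv : 7 * (u * v) ≤ u * v * q := by nlinarith
    rcases pos_and_pos_or_neg_and_neg_of_mul_pos hpr with ⟨hp0, hr0⟩ | ⟨hp0, hr0⟩
    · have hrv : q ≤ r * v := by nlinarith [nonneg_of_mul_nonneg_right hr hr0]
      -- From 4pr = q² - 5 < q² and q ≤ rv; it bounds 2pu by half of uvq, so the invariant exceeds
      -- 7uv/2.
      have h4 : 4 * p ≤ v * q := by
        have : 4 * p * q ≤ v * q * q := by nlinarith [mul_le_mul_of_nonneg_left hrv hp0.le]
        exact le_of_mul_le_mul_right this hq
      nlinarith [mul_le_mul_of_nonneg_left h4 (by linarith : (0 : ℤ) ≤ u)]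
    · have hpu : p * u + q ≤ 0 := by
        by_contra hcon
        push Not at hcon
        nlinarith
      have h4 : 4 * -r ≤ u * q := by
        have : 4 * -r * q ≤ u * q * q := by nlinarith
        exact le_of_mul_le_mul_right this hq
      nlinarith [mul_le_mul_of_nonneg_left h4 (by linarith : (0 : ℤ) ≤ v)]

/-- The joint invariant of the form `v X ^ 2 - u v X Y - u Y ^ 2` and of a form of discriminant `5`
does not take values in an interval around the geometric mean of the discriminants. -/
theorem pairing_gap {u v : ℤ} (hu : 9 ≤ u) (huv : u ≤ v) (p q r : ℤ)
    (hdisc : q ^ 2 - 4 * p * r = 5) :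
    3 * u * v - 2 * v + 2 * u ≤ |u * v * q + 2 * r * v - 2 * p * u| ∨
      |u * v * q + 2 * r * v - 2 * p * u| ≤ u * v + 2 * u + 2 * v := by
  induction hn : q.natAbs using Nat.strong_induction_on generalizing p q r with
  | _ n ih =>
    subst hn
    -- The two substitutions are X ↦ u - X and 1/X ↦ -v - 1/X. Each interchanges the roots of vX² -
    -- uvX - u and fixes the invariant; if neither shortens q, the form is reduced.
    by_cases h1 : (-q - 2 * p * u).natAbs < q.natAbs
    · have := ih _ h1 p (-q - 2 * p * u) (p * u ^ 2 + q * u + r) (by linear_combination hdisc) rfl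
      convert this using 3 <;> ring
    by_cases h2 : (2 * r * v - q).natAbs < q.natAbs
    · have := ih _ h2 (r * v ^ 2 - q * v + p) (2 * r * v - q) r (by linear_combination hdisc) rfl
      convert this using 3 <;> ring
    have hp : 0 ≤ p * (p * u + q) := by
      rw [Int.natAbs_lt_iff_sq_lt] at h1
      by_contra hcon
      push Not at hcon
      apply h1
      nlinarith
    have hr : 0 ≤ r * (r * v - q) := by
      rw [Int.natAbs_lt_iff_sq_lt] at h2
      by_contra hcon
      push Not at hcon
      apply h2
      nlinarith
    rcases lt_trichotomy q 0 with hq | rfl | hq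
    · have := pairing_gap_of_reduced (p := -p) (q := -q) (r := -r) hu huv (by linarith)
        (by linear_combination hdisc) (by linarith) (by linarith)
      rw [← abs_neg]
      convert this using 3 <;> ring
    · exfalso
      ring_nf at hdisc
      omega
    · exact pairing_gap_of_reduced hu huv hq hdisc hp hr

/-! ### The periodic continued fractions and Galois conjugation. -/

theorem one_le_betaCF {u v : ℕ} (hu : 1 ≤ u) (hv : 1 ≤ v) : 1 ≤ betaCF u v := by
  have key : ∀ n u v : ℕ, 1 ≤ u → 1 ≤ v → 1 ≤ finCF (altSeq u v) n := by
    intro n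
    induction n with
    | zero => intro u v hu hv; simpa [finCF, altSeq] using hu
    | succ n ih =>
      intro u v hu hv
      have hs : (fun k => altSeq u v (k + 1)) = altSeq v u := by
        funext k
        simp only [altSeq, Nat.even_add_one]
        by_cases h : Even k <;> simp [h]
      rw [finCF, hs]
      have h1 := ih v u hv hu
      have h2 : (0 : ℝ) ≤ 1 / finCF (altSeq v u) n := by positivity
      have h3 : (1 : ℝ) ≤ u := by exact_mod_cast hu
      simp only [altSeq, Even.zero, if_true]
      linarith
  exact ge_of_tendsto' (tendsto_betaCF u v hu hv) fun n => key n u v hu hv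

theorem betaCF_eq_add_inv {u v : ℕ} (hu : 1 ≤ u) (hv : 1 ≤ v) :
    betaCF u v = u + 1 / betaCF v u := by
  have hs : (fun k => altSeq u v (k + 1)) = altSeq v u := by
    funext k
    simp only [altSeq, Nat.even_add_one]
    by_cases h : Even k <;> simp [h]
  have h1 := (tendsto_betaCF u v hu hv).comp (tendsto_add_atTop_nat 1)
  have h2 : Tendsto (fun n => (u : ℝ) + 1 / finCF (altSeq v u) n) atTop
      (𝓝 (u + 1 / betaCF v u)) :=
    tendsto_const_nhds.add (tendsto_const_nhds.div (tendsto_betaCF v u hv hu)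
      (by linarith [one_le_betaCF hv hu]))
  refine tendsto_nhds_unique h1 (h2.congr fun n => ?_)
  simp only [Function.comp, finCF, hs]
  simp [altSeq]

theorem betaCF_quadratic {u v : ℕ} (hu : 1 ≤ u) (hv : 1 ≤ v) :
    (v : ℝ) * betaCF u v ^ 2 - u * v * betaCF u v - u = 0 := by
  have hx := betaCF_eq_add_inv hu hv
  have hy := betaCF_eq_add_inv hv hu
  have hx1 := one_le_betaCF hu hv
  have hy1 := one_le_betaCF hv hu
  generalize betaCF u v = x at *
  generalize betaCF v u = y at *
  have hxy : x * y = u * y + 1 := by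
    rw [hx]; field_simp
  have hyx : x * y = v * x + 1 := by
    rw [hy]; field_simp
  have hy0 : y ≠ 0 := by positivity
  apply mul_left_cancel₀ hy0
  linear_combination (v * x + 1) * hxy - hyx

/-- The discriminant u²v² + 4uv lies strictly between (uv+1)² and (uv+2)². -/
theorem irrational_betaCF {u v : ℕ} (hu : 1 ≤ u) (hv : 1 ≤ v) : Irrational (betaCF u v) := by
  rintro ⟨t, ht⟩
  have h := betaCF_quadratic hu hv
  rw [← ht] at h
  have h' : (v : ℚ) * t ^ 2 - u * v * t - u = 0 := by exact_mod_cast h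
  have hsq : IsSquare (((u ^ 2 * v ^ 2 + 4 * u * v : ℕ) : ℚ)) := by
    refine ⟨2 * v * t - u * v, ?_⟩
    push_cast
    linear_combination (-4 * (v : ℚ)) * h'
  rw [Rat.isSquare_natCast_iff] at hsq
  obtain ⟨k, hk⟩ := hsq
  have huv : 1 ≤ u * v := Nat.mul_pos hu hv
  have h1 : u * v + 1 < k := by
    by_contra hc
    push Not at hc
    nlinarith [Nat.mul_le_mul hc hc]
  have h2 : k < u * v + 2 := by
    by_contra hc
    push Not at hc
    nlinarith [Nat.mul_le_mul hc hc]
  omega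

/-- An irrational real number with a companion such that the sum and the product are rational has
that companion as its Galois conjugate. -/
theorem galConj_eq_of_add_of_mul {x x' : ℝ} (hx : Irrational x) (s p : ℚ) (hs : x + x' = s)
    (hp : x * x' = p) : galConj x = x' := by
  set f : Polynomial ℚ := Polynomial.X ^ 2 + (-Polynomial.C s * Polynomial.X + Polynomial.C p)
    with hf
  have hdeg : (-Polynomial.C s * Polynomial.X + Polynomial.C p).degree < ((2 : ℕ) : WithBot ℕ) := by
    rw [← Polynomial.C_neg]
    exact lt_of_le_of_lt Polynomial.degree_linear_le (by norm_num)
  have hmon : f.Monic := Polynomial.monic_X_pow_add hdeg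
  have hnat : f.natDegree = 2 := Polynomial.natDegree_eq_of_degree_eq_some (by
    rw [hf, Polynomial.degree_add_eq_left_of_degree_lt] <;> simp only [Polynomial.degree_X_pow]
    exact hdeg)
  have hroot : Polynomial.aeval x f = 0 := by
    simp only [hf, map_add, map_mul, map_neg, map_pow, Polynomial.aeval_X, Polynomial.aeval_C,
      eq_ratCast]
    rw [← hs, ← hp]
    ring
  have hint : IsIntegral ℚ x := ⟨f, hmon, hroot⟩
  have h2 : 2 ≤ (minpoly ℚ x).natDegree := by
    rw [minpoly.two_le_natDegree_iff hint]
    rintro ⟨q, hq⟩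
    exact hx ⟨q, by simpa using hq⟩
  have hmin : f = minpoly ℚ x :=
    Polynomial.eq_of_monic_of_dvd_of_natDegree_le (minpoly.monic hint) hmon
      (minpoly.dvd ℚ x hroot) (by rw [hnat]; exact h2)
  rw [galConj, ← hmin]
  have hc : f.coeff 1 = -s := by
    rw [hf]
    simp [Polynomial.coeff_X_pow, Polynomial.coeff_C]
  rw [hc]
  push_cast
  linarith

/-! ### Pairs of conjugates under GL(2,ℤ) and the set Θ. -/

theorem mul_add_ne_zero_of_irrational {x : ℝ} (hx : Irrational x) {c d : ℤ}
    (h : c ≠ 0 ∨ d ≠ 0) : (c : ℝ) * x + d ≠ 0 := by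
  intro h0
  by_cases hc : c = 0
  · subst hc
    have : (d : ℝ) = 0 := by simpa using h0
    have : d = 0 := by exact_mod_cast this
    tauto
  · have hc' : (c : ℝ) ≠ 0 := by exact_mod_cast hc
    refine hx ⟨-d / c, ?_⟩
    push_cast
    field_simp
    linarith

theorem bottom_row_ne_zero {a b c d : ℤ} (h : a * d - b * c = 1 ∨ a * d - b * c = -1) :
    c ≠ 0 ∨ d ≠ 0 := by
  by_contra hcon
  push Not at hcon
  obtain ⟨rfl, rfl⟩ := hcon
  simp at h

/-- `(β, β')` is the image of `(α, α')` under an element of `GL(2, ℤ)`. -/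
def IsGLPair (α α' β β' : ℝ) : Prop :=
  ∃ a b c d : ℤ, (a * d - b * c = 1 ∨ a * d - b * c = -1) ∧
    β = (a * α + b) / (c * α + d) ∧ β' = (a * α' + b) / (c * α' + d)

theorem fractional_linear_comp (a b c d p q r s : ℤ) {x : ℝ} (h : (r : ℝ) * x + s ≠ 0) :
    ((a : ℝ) * ((p * x + q) / (r * x + s)) + b) / (c * ((p * x + q) / (r * x + s)) + d) =
      ((a * p + b * r : ℤ) * x + (a * q + b * s : ℤ)) /
        ((c * p + d * r : ℤ) * x + (c * q + d * s : ℤ)) := by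
  have h1 : (a : ℝ) * ((p * x + q) / (r * x + s)) + b =
      ((a * p + b * r : ℤ) * x + (a * q + b * s : ℤ)) / (r * x + s) := by
    rw [eq_div_iff h, add_mul, mul_assoc, div_mul_cancel₀ _ h]
    push_cast
    ring
  have h2 : (c : ℝ) * ((p * x + q) / (r * x + s)) + d =
      ((c * p + d * r : ℤ) * x + (c * q + d * s : ℤ)) / (r * x + s) := by
    rw [eq_div_iff h, add_mul, mul_assoc, div_mul_cancel₀ _ h]
    push_cast
    ring
  rw [h1, h2, div_div_div_cancel_right₀ h]

theorem IsGLPair.comp {α α' β β' : ℝ} (hα : Irrational α) (hα' : Irrational α')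
    (h : IsGLPair α α' β β') {a b c d : ℤ} (hdet : a * d - b * c = 1 ∨ a * d - b * c = -1) :
    IsGLPair α α' ((a * β + b) / (c * β + d)) ((a * β' + b) / (c * β' + d)) := by
  obtain ⟨p, q, r, s, hpq, rfl, rfl⟩ := h
  have hrow := bottom_row_ne_zero hpq
  refine ⟨a * p + b * r, a * q + b * s, c * p + d * r, c * q + d * s, ?_,
    fractional_linear_comp a b c d p q r s (mul_add_ne_zero_of_irrational hα hrow),
    fractional_linear_comp a b c d p q r s (mul_add_ne_zero_of_irrational hα' hrow)⟩
  have : (a * p + b * r) * (c * q + d * s) - (a * q + b * s) * (c * p + d * r) =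
      (a * d - b * c) * (p * s - q * r) := by ring
  rw [this]
  rcases hdet with h | h <;> rcases hpq with h' | h' <;> rw [h, h'] <;> norm_num

theorem IsGLPair.irrational {α α' β β' : ℝ} (hα : Irrational α) (h : IsGLPair α α' β β') :
    Irrational β := by
  obtain ⟨a, b, c, d, hdet, rfl, -⟩ := h
  have hden := mul_add_ne_zero_of_irrational hα (bottom_row_ne_zero hdet)
  rintro ⟨t, ht⟩
  have hz : ((t.num * c - t.den * a : ℤ) : ℝ) * α + (t.num * d - t.den * b : ℤ) = 0 := by
    have ht' : (t : ℝ) = t.num / t.den := by exact_mod_cast (Rat.num_div_den t).symm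
    have hd0 : (t.den : ℝ) ≠ 0 := by exact_mod_cast t.den_nz
    rw [ht', div_eq_div_iff hd0 hden] at ht
    push_cast
    linarith
  by_cases hne : t.num * c - t.den * a ≠ 0 ∨ t.num * d - t.den * b ≠ 0
  · exact mul_add_ne_zero_of_irrational hα hne hz
  · push Not at hne
    have h1 : (t.den : ℤ) * (a * d - b * c) = 0 := by
      linear_combination -d * hne.1 + c * hne.2
    have h2 : (t.den : ℤ) ≠ 0 := by exact_mod_cast t.den_nz
    rcases hdet with h | h <;> rw [h] at h1 <;> omega

theorem IsGLPair.galConj_eq {α α' β β' : ℝ} (hα : Irrational α) (hα' : Irrational α') {s p : ℚ}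
    (hs : α + α' = s) (hp : α * α' = p) (h : IsGLPair α α' β β') : galConj β = β' := by
  have hβ := h.irrational hα
  obtain ⟨a, b, c, d, hdet, rfl, rfl⟩ := h
  have h1 := mul_add_ne_zero_of_irrational hα (bottom_row_ne_zero hdet)
  have h2 := mul_add_ne_zero_of_irrational hα' (bottom_row_ne_zero hdet)
  have hN : ((c : ℝ) * α + d) * (c * α' + d) = ((c ^ 2 * p + c * d * s + d ^ 2 : ℚ) : ℝ) := by
    push_cast
    rw [← hs, ← hp]
    ring
  refine galConj_eq_of_add_of_mul hβ
    ((2 * a * c * p + (a * d + b * c) * s + 2 * b * d) / (c ^ 2 * p + c * d * s + d ^ 2))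
    ((a ^ 2 * p + a * b * s + b ^ 2) / (c ^ 2 * p + c * d * s + d ^ 2)) ?_ ?_
  · rw [Rat.cast_div, ← hN, div_add_div _ _ h1 h2]
    congr 1
    push_cast
    rw [← hs, ← hp]
    ring
  · rw [Rat.cast_div, ← hN, div_mul_div_comm]
    congr 1
    push_cast
    rw [← hs, ← hp]
    ring

theorem IsGLPair.sub_eq {α α' β β' : ℝ} (hα : Irrational α) (hα' : Irrational α')
    {a b c d : ℤ} (hdet : a * d - b * c = 1 ∨ a * d - b * c = -1)
    (hβ : β = (a * α + b) / (c * α + d)) (hβ' : β' = (a * α' + b) / (c * α' + d)) :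
    β - β' = (a * d - b * c : ℤ) * (α - α') / ((c * α + d) * (c * α' + d)) := by
  have h1 := mul_add_ne_zero_of_irrational hα (bottom_row_ne_zero hdet)
  have h2 := mul_add_ne_zero_of_irrational hα' (bottom_row_ne_zero hdet)
  rw [hβ, hβ', div_sub_div _ _ h1 h2]
  congr 1
  push_cast
  ring

theorem betaCF_conj_eqs {u v : ℕ} (hu : 1 ≤ u) (hv : 1 ≤ v) :
    betaCF u v + -1 / betaCF v u = ((u : ℚ) : ℝ) ∧
      betaCF u v * (-1 / betaCF v u) = ((-u / v : ℚ) : ℝ) := by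
  have hx := betaCF_eq_add_inv hu hv
  have hy := betaCF_eq_add_inv hv hu
  have hx1 := one_le_betaCF hu hv
  have hy1 := one_le_betaCF hv hu
  have hv0 : (v : ℝ) ≠ 0 := by positivity
  refine ⟨?_, ?_⟩
  · rw [Rat.cast_natCast]
    rw [neg_div]
    linarith
  · have e1 : betaCF u v * betaCF v u = u * betaCF v u + 1 := by
      conv_lhs => rw [hx]
      field_simp
    have e2 : betaCF u v * betaCF v u = v * betaCF u v + 1 := by
      conv_lhs => rw [hy]
      field_simp
    push_cast
    field_simp
    linarith

theorem irrational_neg_inv_betaCF {u v : ℕ} (hu : 1 ≤ u) (hv : 1 ≤ v) :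
    Irrational (-1 / betaCF v u) := by
  rw [neg_div, one_div, irrational_neg_iff, irrational_inv_iff]
  exact irrational_betaCF hv hu

theorem galConj_betaCF {u v : ℕ} (hu : 1 ≤ u) (hv : 1 ≤ v) :
    galConj (betaCF u v) = -1 / betaCF v u :=
  galConj_eq_of_add_of_mul (irrational_betaCF hu hv) _ _ (betaCF_conj_eqs hu hv).1
    (betaCF_conj_eqs hu hv).2

/-- The map X ↦ u - X has determinant -1 and carries x to its conjugate, so the two PSL(2,ℤ)-orbits
together form one GL(2,ℤ)-orbit. -/
theorem exists_isGLPair_of_mem_orbitTheta {u v : ℕ} (hu : 1 ≤ u) (hv : 1 ≤ v) {β : ℝ}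
    (h : β ∈ orbitTheta (betaCF u v)) :
    ∃ β', IsGLPair (betaCF u v) (-1 / betaCF v u) β β' := by
  obtain ⟨g, h | h⟩ := h
  · refine ⟨_, g 0 0, g 0 1, g 1 0, g 1 1, Or.inl ?_, h, rfl⟩
    rw [← Matrix.det_fin_two, g.det_coe]
  · rw [galConj_betaCF hu hv] at h
    have hs := (betaCF_conj_eqs hu hv).1
    have hdet := g.det_coe
    rw [Matrix.det_fin_two] at hdet
    refine ⟨_, -g 0 0, g 0 0 * u + g 0 1, -g 1 0, g 1 0 * u + g 1 1, Or.inr ?_, ?_, rfl⟩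
    · linear_combination -hdet
    · rw [h, moebius]
      have : -1 / betaCF v u = u - betaCF u v := by
        rw [Rat.cast_natCast] at hs
        linarith
      rw [this]
      push_cast
      congr 1 <;> ring

theorem IsGLPair.mem_orbitTheta {u v : ℕ} (hu : 1 ≤ u) (hv : 1 ≤ v) {β β' : ℝ}
    (h : IsGLPair (betaCF u v) (-1 / betaCF v u) β β') : β ∈ orbitTheta (betaCF u v) := by
  obtain ⟨a, b, c, d, hdet | hdet, rfl, -⟩ := h
  · exact ⟨⟨!![a, b; c, d], by rw [Matrix.det_fin_two_of, hdet]⟩, Or.inl (by simp [moebius])⟩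
  · refine ⟨⟨!![-a, a * u + b; -c, c * u + d], ?_⟩, Or.inr ?_⟩
    · rw [Matrix.det_fin_two_of]
      linear_combination -hdet
    · rw [galConj_betaCF hu hv]
      have hs := (betaCF_conj_eqs hu hv).1
      have : -1 / betaCF v u = u - betaCF u v := by
        rw [Rat.cast_natCast] at hs
        linarith
      rw [this]
      simp only [moebius, Matrix.of_apply, Matrix.cons_val', Matrix.cons_val_zero,
        Matrix.cons_val_one, Matrix.cons_val_fin_one]
      push_cast
      congr 1 <;> ring

theorem IsGLPair.galConj_eq_of_betaCF {u v : ℕ} (hu : 1 ≤ u) (hv : 1 ≤ v) {β β' : ℝ}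
    (h : IsGLPair (betaCF u v) (-1 / betaCF v u) β β') : galConj β = β' :=
  h.galConj_eq (irrational_betaCF hu hv) (irrational_neg_inv_betaCF hu hv)
    (betaCF_conj_eqs hu hv).1 (betaCF_conj_eqs hu hv).2

/-! ### The lower bound at the golden ratio. -/

/-- By `hK`, the upper end of the gap is (1+K)T. Above the gap, |J| - T ≥ KT at once; below it, T -
|J| ≥ KT reduces to T ≥ 2uv + 2u. -/
theorem mul_le_abs_add_of_pairing {u v : ℤ} (hu : 9 ≤ u) (huv : u ≤ v) (p q r e : ℤ)
    (hdisc : q ^ 2 - 4 * p * r = 5) (he : e = 1 ∨ e = -1) {K T : ℝ} (hT : 0 < T)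
    (hT2 : T ^ 2 = 5 * ((u : ℝ) ^ 2 * v ^ 2 + 4 * u * v))
    (hK : (1 + K) * T = 3 * u * v - 2 * v + 2 * u) :
    K * T ≤ |((u * v * q + 2 * r * v - 2 * p * u : ℤ) : ℝ) + e * T| := by
  have hu' : (9 : ℝ) ≤ u := by exact_mod_cast hu
  have huv' : (u : ℝ) ≤ v := by exact_mod_cast huv
  have habs : |(e : ℝ) * T| = T := by
    rcases he with rfl | rfl <;> simp [abs_of_pos hT]
  generalize hJ : u * v * q + 2 * r * v - 2 * p * u = J
  rcases pairing_gap hu huv p q r hdisc with h | h <;> rw [hJ] at h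
  · have h' : 3 * u * v - 2 * v + 2 * u ≤ |(J : ℝ)| := by exact_mod_cast h
    have := abs_sub_abs_le_abs_sub (J : ℝ) (-(e * T))
    rw [abs_neg, habs, sub_neg_eq_add] at this
    linarith
  · have h' : |(J : ℝ)| ≤ u * v + 2 * u + 2 * v := by exact_mod_cast h
    have hTl : 2 * (u * v) + 2 * u ≤ T := by
      apply le_of_sq_le_sq _ hT.le
      rw [hT2]
      -- This is T² - (2uv + 2u)².
      have : 0 ≤ (u : ℝ) * (u * (v * (v - 8)) + 20 * v - 4 * u) := by
        apply mul_nonneg (by linarith)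
        have h3 : 0 ≤ (u : ℝ) * (v * (v - 8)) := by
          apply mul_nonneg (by linarith) (mul_nonneg (by linarith) (by linarith))
        linarith
      linarith
    have := abs_sub_abs_le_abs_sub (e * T) (-(J : ℝ))
    rw [abs_neg, habs, sub_neg_eq_add, add_comm] at this
    linarith

theorem IsGLPair.mul_le_golden {u v : ℤ} (hu : 9 ≤ u) (huv : u ≤ v) {x x' β β' K : ℝ}
    (hx : Irrational x) (hx' : Irrational x') (hlt : x' < x) (hadd : x + x' = u)
    (hmul : v * (x * x') = -u)
    (hK : (1 + K) * (√5 * (v * (x - x'))) = 3 * u * v - 2 * v + 2 * u)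
    (h : IsGLPair x x' β β') :
    K * √5 * |β - β'| ≤ 2 * |β - Real.goldenRatio| * |β' - Real.goldenConj| := by
  obtain ⟨a, b, c, d, hdet, hβ, hβ'⟩ := h
  have hu' : (9 : ℝ) ≤ u := by exact_mod_cast hu
  have huv' : (u : ℝ) ≤ v := by exact_mod_cast huv
  have hv0 : (0 : ℝ) < v := by linarith
  have h5 : (0 : ℝ) < √5 := by positivity
  have h55 : √5 ^ 2 = (5 : ℝ) := Real.sq_sqrt (by norm_num)
  have h1 := mul_add_ne_zero_of_irrational hx (bottom_row_ne_zero hdet)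
  have h2 := mul_add_ne_zero_of_irrational hx' (bottom_row_ne_zero hdet)
  have hsub := IsGLPair.sub_eq hx hx' hdet hβ hβ'
  set e := a * d - b * c with he
  have hee : e ^ 2 = 1 := by rcases hdet with h | h <;> rw [h] <;> norm_num
  have hT : 0 < √5 * (v * (x - x')) := by
    have := sub_pos.mpr hlt
    positivity
  -- The coefficients are those of X² - XY - Y² at (aX + bY, cX + dY), a form of discriminant 5e².
  have key := mul_le_abs_add_of_pairing hu huv (a ^ 2 - a * c - c ^ 2)
    (2 * a * b - a * d - b * c - 2 * c * d) (b ^ 2 - b * d - d ^ 2) e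
    (by linear_combination 5 * hee + 5 * (e + (a * d - b * c)) * he.symm) hdet hT
    (by
      rw [mul_pow, h55, mul_pow]
      have : (v : ℝ) ^ 2 * (x - x') ^ 2 = v ^ 2 * (x + x') ^ 2 - 4 * v * (v * (x * x')) := by ring
      rw [this, hadd, hmul]
      ring) hK
  set N := ((c : ℝ) * x + d) * (c * x' + d) with hN
  have hN0 : N ≠ 0 := mul_ne_zero h1 h2
  have hNpos : 0 < |N| := abs_pos.mpr hN0
  have hφ : Real.goldenRatio = (1 + √5) / 2 := rfl
  have hψ : Real.goldenConj = (1 - √5) / 2 := rfl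
  have hprod : v * (2 * (β - Real.goldenRatio) * (β' - Real.goldenConj) * N) =
      ((u * v * (2 * a * b - a * d - b * c - 2 * c * d) + 2 * (b ^ 2 - b * d - d ^ 2) * v -
        2 * (a ^ 2 - a * c - c ^ 2) * u : ℤ) : ℝ) + e * (√5 * (v * (x - x'))) := by
    have e1 : β * (c * x + d) = a * x + b := by rw [hβ, div_mul_cancel₀ _ h1]
    have e2 : β' * (c * x' + d) = a * x' + b := by rw [hβ', div_mul_cancel₀ _ h2]
    have : 2 * (β - Real.goldenRatio) * (β' - Real.goldenConj) * N =
        2 * (a * x + b - Real.goldenRatio * (c * x + d)) *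
          (a * x' + b - Real.goldenConj * (c * x' + d)) := by
      rw [← e1, ← e2, hN]; ring
    rw [this, hφ, hψ, he]
    push_cast
    linear_combination (2 * (a ^ 2 - a * c - c ^ 2)) * hmul +
      v * (2 * a * b - a * d - b * c - 2 * c * d) * hadd +
      (-(1 / 2) * v * ((c * x + d) * (c * x' + d))) * h55
  have habs : |(e : ℝ)| = 1 := by rcases hdet with h | h <;> rw [h] <;> norm_num
  have hd : |β - β'| * |N| = x - x' := by
    rw [← abs_mul, hsub, div_mul_cancel₀ _ hN0, abs_mul, habs, one_mul,
      abs_of_pos (sub_pos.mpr hlt)]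
  rw [← hprod] at key
  simp only [abs_mul, abs_of_pos hv0, abs_two] at key
  have : v * |N| * (K * √5 * |β - β'|) ≤
      v * |N| * (2 * |β - Real.goldenRatio| * |β' - Real.goldenConj|) := by
    calc v * |N| * (K * √5 * |β - β'|) = K * (√5 * (v * (|β - β'| * |N|))) := by ring
      _ = K * (√5 * (v * (x - x'))) := by rw [hd]
      _ ≤ _ := by linarith
  exact le_of_mul_le_mul_left this (by positivity)

/-- If the ratio is below c and δ = |β - β'| is small, then β is within cδ/2 of φ, hence |β' - ψ| ≤
√5 + δ + cδ/2. The hypothesis then contradicts c < K as δ → 0. -/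
theorem le_approxConst_goldenRatio {α K : ℝ}
    (h : ∀ β ∈ orbitTheta α, β ≠ galConj β ∧ K * √5 * |β - galConj β| ≤
      2 * |β - Real.goldenRatio| * |galConj β - Real.goldenConj|) :
    (K : EReal) ≤ approxConst α Real.goldenRatio := by
  refine EReal.ge_of_forall_gt_iff_ge.mp fun c hc => ?_
  have hc : c < K := by exact_mod_cast hc
  refine le_liminf_of_le (by isBoundedDefault) ?_
  have h5 : (0 : ℝ) < √5 := by positivity
  have hcont : Tendsto (fun δ : ℝ => c * (√5 + δ + c * δ / 2)) (𝓝 0) (𝓝 (c * √5)) := by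
    have : Continuous fun δ : ℝ => c * (√5 + δ + c * δ / 2) := by fun_prop
    simpa using this.tendsto 0
  have hev : ∀ᶠ δ : ℝ in 𝓝 0, c * (√5 + δ + c * δ / 2) < K * √5 :=
    hcont.eventually_lt_const (by gcongr)
  rw [eventually_inf_principal]
  refine (hev.comap fun β : ℝ => |β - galConj β|).mono fun β hβ hmem => ?_
  rw [EReal.coe_le_coe_iff]
  obtain ⟨hne, hle⟩ := h β hmem
  have hδ : 0 < |β - galConj β| := abs_pos.mpr (sub_ne_zero.mpr hne)
  by_contra hcon
  push Not at hcon
  set δ := |β - galConj β| with hδdef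
  rw [abs_sub_comm Real.goldenRatio β] at hcon
  have h1 : 2 * |β - Real.goldenRatio| < c * δ := by
    rw [← mul_div_assoc, div_lt_iff₀ hδ] at hcon
    exact hcon
  have hc0 : 0 < c := by
    by_contra hc0
    push Not at hc0
    nlinarith [abs_nonneg (β - Real.goldenRatio)]
  have h2 : |galConj β - Real.goldenConj| ≤ √5 + δ + c * δ / 2 := by
    have e : galConj β - Real.goldenConj =
        (galConj β - β) + (β - Real.goldenRatio) + √5 := by
      rw [← Real.goldenRatio_sub_goldenConj]; ring
    rw [e]
    refine (abs_add_le _ _).trans ?_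
    have := abs_add_le (galConj β - β) (β - Real.goldenRatio)
    rw [abs_sub_comm (galConj β)] at this
    rw [abs_of_pos h5]
    linarith
  have h3 : K * √5 * δ ≤ c * (√5 + δ + c * δ / 2) * δ := by
    calc K * √5 * δ ≤ _ := hle
      _ ≤ (c * δ) * (√5 + δ + c * δ / 2) := by
        gcongr
      _ = _ := by ring
  have h4 := le_of_mul_le_mul_right h3 hδ
  linarith

/-! ### Transporting approximants along the continued fraction of ξ. -/

noncomputable section

/-- The complete quotients `ξ₁, ξ₂, …` of the continued fraction expansion of `ξ`. -/
def completeQuotient (ξ : ℝ) : ℕ → ℝ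
  | 0 => (Int.fract ξ)⁻¹
  | n + 1 => (Int.fract (completeQuotient ξ n))⁻¹

/-- The quotients of consecutive denominators of the convergents of `ξ`. -/
def denominatorQuotient (ξ : ℝ) : ℕ → ℝ
  | 0 => 0
  | n + 1 => (⌊completeQuotient ξ n⌋ + denominatorQuotient ξ n)⁻¹

theorem irrational_inv_fract {x : ℝ} (h : Irrational x) : Irrational (Int.fract x)⁻¹ := by
  rw [irrational_inv_iff, Int.fract, irrational_sub_intCast_iff]
  exact h

theorem one_lt_inv_fract {x : ℝ} (h : Irrational x) : 1 < (Int.fract x)⁻¹ := by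
  have h0 : 0 < Int.fract x := by
    refine lt_of_le_of_ne (Int.fract_nonneg x) fun h0 => ?_
    have := irrational_inv_fract h
    rw [← h0, inv_zero] at this
    exact not_irrational_zero this
  exact (one_lt_inv₀ h0).mpr (Int.fract_lt_one x)

theorem irrational_completeQuotient {ξ : ℝ} (h : Irrational ξ) (n : ℕ) :
    Irrational (completeQuotient ξ n) := by
  induction n with
  | zero => exact irrational_inv_fract h
  | succ n ih => exact irrational_inv_fract ih

theorem one_lt_completeQuotient {ξ : ℝ} (h : Irrational ξ) (n : ℕ) :
    1 < completeQuotient ξ n := by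
  cases n with
  | zero => exact one_lt_inv_fract h
  | succ n => exact one_lt_inv_fract (irrational_completeQuotient h n)

theorem one_le_floor_completeQuotient {ξ : ℝ} (h : Irrational ξ) (n : ℕ) :
    1 ≤ ⌊completeQuotient ξ n⌋ :=
  Int.le_floor.mpr (by exact_mod_cast (one_lt_completeQuotient h n).le)

theorem fract_completeQuotient (ξ : ℝ) (n : ℕ) :
    Int.fract (completeQuotient ξ n) = (completeQuotient ξ (n + 1))⁻¹ := by
  simp [completeQuotient]

theorem denominatorQuotient_mem {ξ : ℝ} (h : Irrational ξ) (n : ℕ) :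
    0 ≤ denominatorQuotient ξ n ∧ denominatorQuotient ξ n ≤ 1 := by
  induction n with
  | zero => simp [denominatorQuotient]
  | succ n ih =>
    have h1 : (1 : ℝ) ≤ ⌊completeQuotient ξ n⌋ := by
      exact_mod_cast one_le_floor_completeQuotient h n
    have h2 : 1 ≤ ⌊completeQuotient ξ n⌋ + denominatorQuotient ξ n := by linarith
    exact ⟨by rw [denominatorQuotient]; positivity, inv_le_one_of_one_le₀ h2⟩

/-- The bound n ≤ c sends the denominators to infinity; n + 1 ≤ c + d is carried along because the
next denominator is at least c + d. -/
theorem exists_matrix_completeQuotient {ξ : ℝ} (h : Irrational ξ) (n : ℕ) :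
    ∃ a b c d : ℤ, (a * d - b * c = 1 ∨ a * d - b * c = -1) ∧
      ξ * (c * completeQuotient ξ n + d) = a * completeQuotient ξ n + b ∧
      1 ≤ c ∧ 0 ≤ d ∧ (n : ℤ) ≤ c ∧ (n : ℤ) + 1 ≤ c + d ∧
      denominatorQuotient ξ n * c = d := by
  induction n with
  | zero =>
    refine ⟨⌊ξ⌋, 1, 1, 0, Or.inr (by ring), ?_, le_rfl, le_rfl, by simp, by simp,
      by simp [denominatorQuotient]⟩
    have h1 := one_lt_inv_fract h
    have h2 : Int.fract ξ ≠ 0 := by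
      intro h0
      rw [h0, inv_zero] at h1
      linarith
    simp only [completeQuotient]
    push_cast
    field_simp
    linarith [Int.floor_add_fract ξ]
  | succ n ih =>
    obtain ⟨a, b, c, d, hdet, hξ, hc, hd, hnc, hncd, hη⟩ := ih
    have hk := one_le_floor_completeQuotient h n
    have hX' := one_lt_completeQuotient h (n + 1)
    have hfr := fract_completeQuotient ξ n
    have hη0 := (denominatorQuotient_mem h n).1
    have hadd := Int.floor_add_fract (completeQuotient ξ n)
    rw [hfr] at hadd
    set k := ⌊completeQuotient ξ n⌋ with hkdef
    set X' := completeQuotient ξ (n + 1) with hX'def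
    have hX0 : X' ≠ 0 := by positivity
    have hck : c ≤ c * k := by nlinarith
    refine ⟨a * k + b, a, c * k + d, c, ?_, ?_, by linarith, by linarith, ?_, ?_, ?_⟩
    · rcases hdet with h | h
      · exact Or.inr (by linear_combination -h)
      · exact Or.inl (by linear_combination -h)
    · rw [← hadd] at hξ
      field_simp at hξ
      push_cast
      linear_combination hξ
    · push_cast; linarith
    · push_cast; linarith
    · have hk' : (1 : ℝ) ≤ k := by exact_mod_cast hk
      have hpos : (k : ℝ) + denominatorQuotient ξ n ≠ 0 := by positivity
      rw [denominatorQuotient, ← hkdef, inv_mul_eq_iff_eq_mul₀ hpos]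
      push_cast
      linear_combination -hη

/-- Some image `(b, b')` of `(α, α')` under `GL(2, ℤ)` approximates a geodesic with end points
`X` and `-η`, with constant at most `C`. -/
def HasApproximant (α α' W X η C : ℝ) : Prop :=
  ∃ b b' : ℝ, IsGLPair α α' b b' ∧ 1 / 2 ≤ b + η ∧ 1 / 2 ≤ |b' + η| ∧ |b - b'| ≤ W ∧
    2 * (|X - b| * |b' + η|) ≤ C * ((X + η) * |b - b'|)

/-- The convergent matrix gives |β - β'| = |b - b'|/(c²(b+η)|b'+η|) and |ξ - β| = |X -
b|/(c²(X+η)(b+η)), so c cancels from the ratio. The factor 4 comes from the two lower bounds 1/2. -/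
theorem HasApproximant.exists_near {α α' W ξ C : ℝ} (hα : Irrational α) (hα' : Irrational α')
    (hne : α ≠ α') (hξ : Irrational ξ) {n : ℕ} (hn : 1 ≤ n)
    (h : HasApproximant α α' W (completeQuotient ξ n) (denominatorQuotient ξ n) C) :
    ∃ β β', IsGLPair α α' β β' ∧ |β - β'| ≤ 4 * W / n ∧ 2 * (|ξ - β| / |β - β'|) ≤ C := by
  obtain ⟨b, b', hb, hbη, hbη', hW, hC⟩ := h
  obtain ⟨p, q, c, d, hdet, hξX, hc, hd, hnc, -, hη⟩ := exists_matrix_completeQuotient hξ n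
  have hX := one_lt_completeQuotient hξ n
  have hη0 := (denominatorQuotient_mem hξ n).1
  generalize completeQuotient ξ n = X at *
  generalize denominatorQuotient ξ n = η at *
  have hbne : b ≠ b' := by
    obtain ⟨p, q, r, s, hdet, h1, h2⟩ := hb
    rw [← sub_ne_zero, IsGLPair.sub_eq hα hα' hdet h1 h2]
    refine div_ne_zero (mul_ne_zero ?_ (sub_ne_zero.mpr hne)) (mul_ne_zero
      (mul_add_ne_zero_of_irrational hα (bottom_row_ne_zero hdet))
      (mul_add_ne_zero_of_irrational hα' (bottom_row_ne_zero hdet)))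
    rcases hdet with h | h <;> rw [h] <;> norm_num
  have hc1 : (1 : ℝ) ≤ c := by exact_mod_cast hc
  have hcn : (n : ℝ) ≤ c := by exact_mod_cast hnc
  have hn1 : (1 : ℝ) ≤ n := by exact_mod_cast hn
  have hc0 : (0 : ℝ) < c := by linarith
  have hA : (c : ℝ) * X + d = c * (X + η) := by rw [← hη]; ring
  have hB : (c : ℝ) * b + d = c * (b + η) := by rw [← hη]; ring
  have hB' : (c : ℝ) * b' + d = c * (b' + η) := by rw [← hη]; ring
  have hw : 0 < X + η := by linarith
  have hbη0 : 0 < b + η := by linarith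
  have hbη0' : b' + η ≠ 0 := by
    intro h0
    rw [h0, abs_zero] at hbη'
    linarith
  have hbb : 0 < |b - b'| := abs_pos.mpr (sub_ne_zero.mpr hbne)
  have hdetabs : |((p * d - q * c : ℤ) : ℝ)| = 1 := by
    rcases hdet with h | h <;> rw [h] <;> norm_num
  refine ⟨_, _, hb.comp hα hα' hdet, ?_⟩
  have hd1 : |(p * b + q) / (c * b + d) - (p * b' + q) / (c * b' + d)| =
      |b - b'| / (c ^ 2 * (b + η) * |b' + η|) := by
    have : ((p : ℝ) * b + q) / (c * b + d) - (p * b' + q) / (c * b' + d) =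
        (p * d - q * c : ℤ) * (b - b') / (c ^ 2 * (b + η) * (b' + η)) := by
      rw [hB, hB', div_sub_div _ _ (mul_pos hc0 hbη0).ne' (mul_ne_zero hc0.ne' hbη0'), ← hB, ← hB',
        show (c : ℝ) ^ 2 * (b + η) * (b' + η) = (c * (b + η)) * (c * (b' + η)) by ring, ← hB, ← hB']
      congr 1
      push_cast
      ring
    have hP : 0 < (c : ℝ) ^ 2 * (b + η) := mul_pos (by positivity) hbη0
    rw [this, abs_div, abs_mul, hdetabs, one_mul, abs_mul, abs_of_pos hP]
  have hd2 : |ξ - (p * b + q) / (c * b + d)| = |X - b| / (c ^ 2 * (X + η) * (b + η)) := by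
    have : ξ - (p * b + q) / (c * b + d) =
        (p * d - q * c : ℤ) * (X - b) / (c ^ 2 * (X + η) * (b + η)) := by
      have hξ' : ξ = (p * X + q) / (c * X + d) := by
        rw [eq_div_iff (by rw [hA]; exact (mul_pos hc0 hw).ne')]
        exact hξX
      rw [hξ', hA, hB, div_sub_div _ _ (mul_pos hc0 hw).ne' (mul_pos hc0 hbη0).ne', ← hA, ← hB,
        show (c : ℝ) ^ 2 * (X + η) * (b + η) = (c * (X + η)) * (c * (b + η)) by ring, ← hA, ← hB]
      congr 1
      push_cast
      ring
    have hP : 0 < (c : ℝ) ^ 2 * (X + η) * (b + η) :=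
      mul_pos (mul_pos (by positivity) hw) hbη0
    rw [this, abs_div, abs_mul, hdetabs, one_mul, abs_of_pos hP]
  have hbpos : 0 < |b' + η| := abs_pos.mpr hbη0'
  rw [hd1, hd2]
  constructor
  · rw [div_le_div_iff₀ (by positivity) (by positivity)]
    have h1 : (n : ℝ) ≤ c ^ 2 := by nlinarith
    have h2 : 1 / 4 ≤ (b + η) * |b' + η| := by nlinarith
    have hW0 : 0 ≤ W := hbb.le.trans hW
    calc |b - b'| * n ≤ W * c ^ 2 := by gcongr
      _ = 4 * W * (c ^ 2 * (1 / 4)) := by ring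
      _ ≤ 4 * W * (c ^ 2 * ((b + η) * |b' + η|)) := by gcongr
      _ = _ := by ring
  · have : 2 * (|X - b| / (c ^ 2 * (X + η) * (b + η)) / (|b - b'| / (c ^ 2 * (b + η) * |b' + η|))) =
        2 * (|X - b| * |b' + η|) / ((X + η) * |b - b'|) := by
      field_simp
    rw [this, div_le_iff₀ (by positivity)]
    exact hC

theorem approxConst_le_of_hasApproximant {u v : ℕ} (hu : 1 ≤ u) (hv : 1 ≤ v) {ξ K : ℝ} (W : ℝ)
    (hξ : Irrational ξ)
    (h : ∀ ε > 0, ∃ᶠ n in atTop, HasApproximant (betaCF u v) (-1 / betaCF v u) W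
      (completeQuotient ξ n) (denominatorQuotient ξ n) (K + ε)) :
    approxConst (betaCF u v) ξ ≤ K := by
  refine EReal.le_of_forall_lt_iff_le.mp fun z hz => ?_
  have hz : K < z := by exact_mod_cast hz
  have hα := irrational_betaCF hu hv
  have hα' := irrational_neg_inv_betaCF hu hv
  have hne : betaCF u v ≠ -1 / betaCF v u := by
    have h1 := one_le_betaCF hu hv
    have h2 := one_le_betaCF hv hu
    have : -1 / betaCF v u ≤ 0 := div_nonpos_of_nonpos_of_nonneg (by norm_num) (by linarith)
    linarith
  refine liminf_le_of_frequently_le' ?_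
  rw [((Metric.nhds_basis_ball.comap fun β : ℝ => |β - galConj β|).inf_principal _).frequently_iff]
  intro ε hε
  obtain ⟨N, hN⟩ := exists_nat_gt (4 * W / ε)
  obtain ⟨n, hn, happ⟩ := frequently_atTop.mp (h (z - K) (by linarith)) (max N 1)
  obtain ⟨β, β', hβ, hd, hle⟩ := happ.exists_near hα hα' hne hξ (le_trans (le_max_right _ _) hn)
  have hconj := hβ.galConj_eq_of_betaCF hu hv
  refine ⟨β, ⟨?_, hβ.mem_orbitTheta hu hv⟩, ?_⟩
  · have hn0 : (0 : ℝ) < n := by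
      have := le_trans (le_max_right _ _) hn
      exact_mod_cast this
    have hNn : (N : ℝ) ≤ n := by exact_mod_cast le_trans (le_max_left _ _) hn
    simp only [Set.mem_preimage, Metric.mem_ball, dist_zero_right, Real.norm_eq_abs, abs_abs,
      hconj]
    refine lt_of_le_of_lt hd ?_
    rw [div_lt_iff₀ hn0]
    have := hN.trans_le hNn
    rwa [div_lt_iff₀ hε, mul_comm (n : ℝ)] at this
  · rw [EReal.coe_le_coe_iff, hconj]
    linarith

end

/-! ### Explicit approximants when a partial quotient is at least 2. -/

theorem HasApproximant.mono {α α' W X η C C' : ℝ} (h : HasApproximant α α' W X η C) (hC : C ≤ C')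
    (hX : 0 ≤ X + η) : HasApproximant α α' W X η C' := by
  obtain ⟨b, b', h1, h2, h3, h4, h5⟩ := h
  exact ⟨b, b', h1, h2, h3, h4, h5.trans (by gcongr)⟩

/-- Equal signs of s and t give |b - b'| = (st+1)/|s|; negative s covers the pair (k - 1/x, k + y).
-/
theorem hasApproximant_of_isGLPair {α α' s t W X η C k : ℝ} (hs : s ≠ 0) (hst : 0 ≤ s * t)
    (hW : |1 / s + t| ≤ W) (hp : IsGLPair α α' (k + 1 / s) (k - t)) (h1 : 1 / 2 ≤ k + 1 / s + η)
    (h2 : 1 / 2 ≤ |k - t + η|)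
    (h3 : 2 * (|(X - k) * s - 1| * |k - t + η|) ≤ C * ((X + η) * (s * t + 1))) :
    HasApproximant α α' W X η C := by
  have hs' : 0 < |s| := abs_pos.mpr hs
  have e1 : |k + 1 / s - (k - t)| = (s * t + 1) / |s| := by
    rw [show k + 1 / s - (k - t) = (s * t + 1) / s by field_simp; ring, abs_div,
      abs_of_pos (by linarith : 0 < s * t + 1)]
  have e2 : |X - (k + 1 / s)| = |(X - k) * s - 1| / |s| := by
    rw [show X - (k + 1 / s) = ((X - k) * s - 1) / s by field_simp; ring, abs_div]
  refine ⟨_, _, hp, h1, h2, ?_, ?_⟩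
  · rwa [show k + 1 / s - (k - t) = 1 / s + t by ring]
  · rw [e1, e2]
    calc 2 * (|(X - k) * s - 1| / |s| * |k - t + η|)
        = 2 * (|(X - k) * s - 1| * |k - t + η|) / |s| := by ring
      _ ≤ C * ((X + η) * (s * t + 1)) / |s| := by gcongr
      _ = _ := by ring

/-- The pairs `(k + 1 / x, k - y)`, `(k + 1 / y, k - x)` and `(k - 1 / x, k + y)` are images of
`(α, α')` under `GL(2, ℤ)`. -/
structure HasStandardPairs (α α' x y : ℝ) : Prop where
  nine_le_left : 9 ≤ x
  nine_le_right : 9 ≤ y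
  inv_left : ∀ k : ℤ, IsGLPair α α' (k + 1 / x) (k - y)
  inv_right : ∀ k : ℤ, IsGLPair α α' (k + 1 / y) (k - x)
  neg_inv_left : ∀ k : ℤ, IsGLPair α α' (k + 1 / -x) (k - -y)

namespace HasStandardPairs

variable {α α' x y K : ℝ}

/-- Here `hK` is a rational lower bound for K(xy+1) = 2(x-φ²)(y+φ²)/(√5φ²), from 0.3416 < 2/(√5φ²)
and 2.618 < φ² < 2.6181; 0.1708 is half of 0.3416. -/
theorem hasApproximant_left (h : HasStandardPairs α α' x y)
    (hK : 3416 / 10000 * ((x - 26181 / 10000) * (y + 2618 / 1000)) ≤ K * (x * y + 1))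
    {k : ℤ} {θ η : ℝ} (hk : 2 ≤ k) (hk6 : k ≤ 6) (hη : 0 ≤ η) (hη1 : η ≤ 1) (hθ : 0 ≤ θ)
    (hle : |θ * x - 1| ≤ 1708 / 10000 * (x - 26181 / 10000) * (k + θ + η)) :
    HasApproximant α α' (x + y) (k + θ) η K := by
  have hx := h.nine_le_left
  have hy := h.nine_le_right
  have hk' : (2 : ℝ) ≤ k := by exact_mod_cast hk
  have hk6' : (k : ℝ) ≤ 6 := by exact_mod_cast hk6
  have hinv : 0 < 1 / x := by positivity
  have hinv1 : 1 / x ≤ 1 := by rw [div_le_one (by linarith)]; linarith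
  have habs : |k - y + η| = y - k - η := by rw [abs_of_nonpos (by linarith)]; ring
  refine hasApproximant_of_isGLPair (by positivity) (by positivity) ?_ (h.inv_left k)
    (by linarith) (by rw [habs]; linarith) ?_
  · rw [abs_of_pos (by positivity)]; linarith
  · rw [habs, add_sub_cancel_left]
    have hw : 0 ≤ k + θ + η := by linarith
    calc 2 * (|θ * x - 1| * (y - k - η))
        ≤ 2 * (1708 / 10000 * (x - 26181 / 10000) * (k + θ + η) * (y + 2618 / 1000)) := by
          refine mul_le_mul_of_nonneg_left (mul_le_mul hle (by linarith) (by linarith) ?_) (by simp)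
          exact mul_nonneg (mul_nonneg (by norm_num) (by linarith)) hw
      _ = 3416 / 10000 * ((x - 26181 / 10000) * (y + 2618 / 1000)) * (k + θ + η) := by ring
      _ ≤ K * (x * y + 1) * (k + θ + η) := by gcongr
      _ = _ := by ring

/-- The bound X + η ≥ 2.5 absorbs the summand 1 of (1-θ)y + 1, since 0.1708·2.618·2.5 > 1. The cap k
≤ 6 keeps b' + η ≤ -1, as x ≥ 9. -/
theorem hasApproximant_right (h : HasStandardPairs α α' x y)
    (hK : 3416 / 10000 * ((x - 26181 / 10000) * (y + 2618 / 1000)) ≤ K * (x * y + 1))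
    {k : ℤ} {θ η : ℝ} (hk : 2 ≤ k) (hk6 : k ≤ 6) (hη : 0 ≤ η) (hη1 : η ≤ 1) (hθ1 : θ ≤ 1)
    (hw : 25 / 10 ≤ k + θ + η) (hle : 1 - θ ≤ 1708 / 10000 * (k + θ + η)) :
    HasApproximant α α' (x + y) (k + θ) η K := by
  have hx := h.nine_le_left
  have hy := h.nine_le_right
  have hk' : (2 : ℝ) ≤ k := by exact_mod_cast hk
  have hk6' : (k : ℝ) ≤ 6 := by exact_mod_cast hk6
  have hinv : 0 < 1 / y := by positivity
  have hinv1 : 1 / y ≤ 1 := by rw [div_le_one (by linarith)]; linarith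
  have hp := h.inv_right (k + 1)
  push_cast at hp
  have habs : |k + 1 - x + η| = x - k - 1 - η := by rw [abs_of_nonpos (by linarith)]; ring
  refine hasApproximant_of_isGLPair (by positivity) (by positivity) ?_ hp
    (by linarith) (by rw [habs]; linarith) ?_
  · rw [abs_of_pos (by positivity)]; linarith
  · have e : |(k + θ - (k + 1)) * y - 1| = (1 - θ) * y + 1 := by
      rw [abs_of_nonpos (by nlinarith)]; ring
    rw [habs, e]
    have h1 : (1 - θ) * y + 1 ≤ 1708 / 10000 * (k + θ + η) * (y + 2618 / 1000) := by
      nlinarith [mul_le_mul_of_nonneg_right hle (by linarith : 0 ≤ y)]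
    calc 2 * (((1 - θ) * y + 1) * (x - k - 1 - η))
        ≤ 2 * (1708 / 10000 * (k + θ + η) * (y + 2618 / 1000) * (x - 26181 / 10000)) := by
          refine mul_le_mul_of_nonneg_left (mul_le_mul h1 (by linarith) (by linarith) ?_) (by simp)
          exact mul_nonneg (mul_nonneg (by norm_num) (by linarith)) (by linarith)
      _ = 3416 / 10000 * ((x - 26181 / 10000) * (y + 2618 / 1000)) * (k + θ + η) := by ring
      _ ≤ K * (x * y + 1) * (k + θ + η) := by gcongr
      _ = _ := by ring

/-- For large k the points k - y and k + 1 - x may come close to -η, so b' is taken on the other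
side, at y plus the integer nearest to X. -/
theorem hasApproximant_of_seven_le (h : HasStandardPairs α α' x y)
    (hK : 3416 / 10000 * ((x - 26181 / 10000) * (y + 2618 / 1000)) ≤ K * (x * y + 1))
    {k : ℤ} {θ η : ℝ} (hk : 7 ≤ k) (hη : 0 ≤ η) (hθ : 0 ≤ θ) (hθ1 : θ ≤ 1) :
    HasApproximant α α' (x + y) (k + θ) η K := by
  have hx := h.nine_le_left
  have hy := h.nine_le_right
  have hk' : (7 : ℝ) ≤ k := by exact_mod_cast hk
  have hinv : 0 < 1 / x := by positivity
  have hinv1 : 1 / x ≤ 1 := by rw [div_le_one (by linarith)]; linarith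
  have hxy : 0 ≤ (x - 9) * (y - 9) := mul_nonneg (by linarith) (by linarith)
  have hx0 : -x ≠ 0 := by linarith
  have hneg : 0 ≤ -x * -y := by rw [neg_mul_neg]; positivity
  have hW : |1 / -x + -y| ≤ x + y := by
    rw [div_neg, ← neg_add, abs_neg, abs_of_pos (by positivity)]; linarith
  have hw : 0 ≤ k + θ + η := by linarith
  rcases le_total θ (1 / 2) with hθ2 | hθ2
  · have e : |k - -y + η| = k + y + η := by rw [abs_of_nonneg (by linarith)]; ring
    refine hasApproximant_of_isGLPair hx0 hneg hW (h.neg_inv_left k) (by rw [div_neg]; linarith)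
      (by rw [e]; linarith) ?_
    rw [e, add_sub_cancel_left, neg_mul_neg]
    have e2 : |θ * -x - 1| = θ * x + 1 := by rw [abs_of_nonpos (by nlinarith)]; ring
    rw [e2]
    -- Equality holds at θ = 1/2; `h2` then reduces to k + η = 7.
    have h1 : (θ * x + 1) * 15 ≤ (x + 2) * (7 + θ) := by nlinarith
    have h2 : (k + η + y) * (7 + θ) ≤ (7 + y) * (k + η + θ) := by
      nlinarith [mul_nonneg (by linarith : 0 ≤ k + η - 7) (by linarith : 0 ≤ y - θ)]
    have h3 : (x + 2) * (7 + y) ≤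
        15 * (1708 / 10000 * ((x - 26181 / 10000) * (y + 2618 / 1000))) := by nlinarith
    calc 2 * ((θ * x + 1) * (k + y + η))
        = 2 / 15 * (((θ * x + 1) * 15) * (k + y + η)) := by ring
      _ ≤ 2 / 15 * (((x + 2) * (7 + θ)) * (k + y + η)) := by
          gcongr
      _ = 2 / 15 * ((x + 2) * ((k + η + y) * (7 + θ))) := by ring
      _ ≤ 2 / 15 * ((x + 2) * ((7 + y) * (k + η + θ))) := by gcongr
      _ = 2 / 15 * ((x + 2) * (7 + y)) * (k + θ + η) := by ring
      _ ≤ 2 / 15 * (15 * (1708 / 10000 * ((x - 26181 / 10000) * (y + 2618 / 1000)))) *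
          (k + θ + η) := by gcongr
      _ = 3416 / 10000 * ((x - 26181 / 10000) * (y + 2618 / 1000)) * (k + θ + η) := by ring
      _ ≤ K * (x * y + 1) * (k + θ + η) := by gcongr
      _ = _ := by ring
  · have e : |(k : ℝ) + 1 - -y + η| = k + 1 + y + η := by rw [abs_of_nonneg (by linarith)]; ring
    have hp := h.neg_inv_left (k + 1)
    push_cast at hp
    refine hasApproximant_of_isGLPair hx0 hneg hW hp (by rw [div_neg]; linarith)
      (by rw [e]; linarith) ?_
    rw [e, neg_mul_neg, show (k + θ - (k + 1)) * -x - 1 = (1 - θ) * x - 1 by ring]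
    have h1 : |(1 - θ) * x - 1| ≤ (x - 2) / 2 := by
      rw [abs_le]
      constructor <;> nlinarith
    -- Equality holds at k = 7, θ = 1/2, η = 0.
    have h2 : (k + 1 + y + η) * 15 ≤ 2 * (8 + y) * (k + θ + η) := by nlinarith
    have h3 : (x - 2) * (8 + y) ≤
        15 * (1708 / 10000 * ((x - 26181 / 10000) * (y + 2618 / 1000))) := by nlinarith
    calc 2 * (|(1 - θ) * x - 1| * (k + 1 + y + η))
        ≤ 2 * ((x - 2) / 2 * (k + 1 + y + η)) := by
          gcongr
      _ = (x - 2) / 15 * ((k + 1 + y + η) * 15) := by ring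
      _ ≤ (x - 2) / 15 * (2 * (8 + y) * (k + θ + η)) := by
          have : 0 ≤ x - 2 := by linarith
          gcongr
      _ = 2 / 15 * ((x - 2) * (8 + y)) * (k + θ + η) := by ring
      _ ≤ 2 / 15 * (15 * (1708 / 10000 * ((x - 26181 / 10000) * (y + 2618 / 1000)))) *
          (k + θ + η) := by gcongr
      _ = 3416 / 10000 * ((x - 26181 / 10000) * (y + 2618 / 1000)) * (k + θ + η) := by ring
      _ ≤ K * (x * y + 1) * (k + θ + η) := by gcongr
      _ = _ := by ring

theorem hasApproximant_of_three_le (h : HasStandardPairs α α' x y)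
    (hK : 3416 / 10000 * ((x - 26181 / 10000) * (y + 2618 / 1000)) ≤ K * (x * y + 1))
    {X η : ℝ} (hX : 3 ≤ X) (hη : 0 ≤ η) (hη1 : η ≤ 1) :
    HasApproximant α α' (x + y) X η K := by
  have hx := h.nine_le_left
  have hθ := Int.fract_nonneg X
  have hθ1 := (Int.fract_lt_one X).le
  have hk : 3 ≤ ⌊X⌋ := Int.le_floor.mpr (by exact_mod_cast hX)
  rw [← Int.floor_add_fract X]
  generalize ⌊X⌋ = k at *
  generalize Int.fract X = θ at *
  have hk' : (3 : ℝ) ≤ k := by exact_mod_cast hk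
  rcases le_or_gt 7 k with h7 | h7
  · exact h.hasApproximant_of_seven_le hK h7 hη hθ hθ1
  rcases le_total θ (1 / 2) with hθ2 | hθ2
  · refine h.hasApproximant_left hK (by linarith) (by linarith) hη hη1 hθ ?_
    have h1 : 1708 / 10000 * (x - 26181 / 10000) * (3 + θ) ≤
        1708 / 10000 * (x - 26181 / 10000) * (k + θ + η) :=
      mul_le_mul_of_nonneg_left (by linarith) (mul_nonneg (by norm_num) (by linarith))
    refine le_trans ?_ h1
    rw [abs_le]
    constructor <;> nlinarith [mul_nonneg hθ (by linarith : 0 ≤ x - 9),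
      mul_nonneg (by linarith : 0 ≤ 1 / 2 - θ) (by linarith : 0 ≤ x - 9)]
  · exact h.hasApproximant_right hK (by linarith) (by linarith) hη hη1 hθ1 (by linarith)
      (by linarith)

/-- Both sufficient conditions fail at θ = 1/2, η = 1/3, so a neighbourhood of 1/2 is excluded. -/
theorem hasApproximant_of_floor_eq_two (h : HasStandardPairs α α' x y)
    (hK : 3416 / 10000 * ((x - 26181 / 10000) * (y + 2618 / 1000)) ≤ K * (x * y + 1))
    {θ η : ℝ} (hη : 1 / 3 ≤ η) (hη1 : η ≤ 1)
    (hθ : (1 / 3 ≤ θ ∧ θ ≤ 3 / 7) ∨ (4 / 7 ≤ θ ∧ θ ≤ 1)) :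
    HasApproximant α α' (x + y) (2 + θ) η K := by
  have hx := h.nine_le_left
  have e : (2 : ℝ) = ((2 : ℤ) : ℝ) := by norm_num
  rcases hθ with ⟨h1, h2⟩ | ⟨h1, h2⟩
  · rw [e]
    refine h.hasApproximant_left hK le_rfl (by norm_num) (by linarith) hη1 (by linarith) ?_
    rw [← e]
    have h3 : 1708 / 10000 * (x - 26181 / 10000) * (7 / 3 + θ) ≤
        1708 / 10000 * (x - 26181 / 10000) * (2 + θ + η) :=
      mul_le_mul_of_nonneg_left (by linarith) (mul_nonneg (by norm_num) (by linarith))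
    refine le_trans ?_ h3
    rw [abs_of_nonneg (by nlinarith)]
    nlinarith [mul_nonneg (by linarith : 0 ≤ θ - 1 / 3) (by linarith : 0 ≤ x - 9),
      mul_nonneg (by linarith : 0 ≤ 3 / 7 - θ) (by linarith : 0 ≤ x - 9)]
  · rw [e]
    refine h.hasApproximant_right hK le_rfl (by norm_num) (by linarith) hη1 h2 ?_ ?_
    · rw [← e]; linarith
    · rw [← e]; linarith

end HasStandardPairs

/-! ### Tails of ones and the case distinction on ξ. -/

theorem inv_goldenRatio_eq_sub_one : Real.goldenRatio⁻¹ = Real.goldenRatio - 1 := by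
  rw [Real.inv_goldenRatio]
  linarith [Real.goldenRatio_add_goldenConj]

/-- On the tail, X ↦ 1 + 1/X takes each complete quotient to the preceding one and contracts towards
φ by at least 1/φ. Going back from arbitrarily far along the tail forces equality. -/
theorem completeQuotient_eq_goldenRatio {ξ : ℝ} (hξ : Irrational ξ) {N : ℕ}
    (h : ∀ n, N ≤ n → completeQuotient ξ n < 2) {n : ℕ} (hn : N ≤ n) :
    completeQuotient ξ n = Real.goldenRatio := by
  have hφ1 := Real.one_lt_goldenRatio
  have hφ2 := Real.goldenRatio_lt_two
  have hφ : Real.goldenRatio = 1 + Real.goldenRatio⁻¹ := by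
    rw [inv_goldenRatio_eq_sub_one]
    ring
  have key : ∀ m n : ℕ, N ≤ n →
      |completeQuotient ξ n - Real.goldenRatio| ≤ Real.goldenRatio⁻¹ ^ m := by
    intro m
    induction m with
    | zero =>
      intro n hn
      have := one_lt_completeQuotient hξ n
      have := h n hn
      rw [pow_zero, abs_le]
      constructor <;> linarith
    | succ m ih =>
      intro n hn
      have h1 := one_lt_completeQuotient hξ n
      have h1' := one_lt_completeQuotient hξ (n + 1)
      have hfl : ⌊completeQuotient ξ n⌋ = 1 := by
        rw [Int.floor_eq_iff]
        constructor
        · exact_mod_cast h1.le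
        · push_cast; linarith [h n hn]
      have hrec : completeQuotient ξ n = 1 + (completeQuotient ξ (n + 1))⁻¹ := by
        rw [← fract_completeQuotient, Int.fract, hfl]
        push_cast
        ring
      have hih := ih (n + 1) (by omega)
      generalize completeQuotient ξ (n + 1) = X at *
      have e : completeQuotient ξ n - Real.goldenRatio =
          -(X - Real.goldenRatio) * (X⁻¹ * Real.goldenRatio⁻¹) := by
        rw [hrec]
        conv_lhs => rw [hφ]
        field_simp
        ring
      have hpos : 0 < X⁻¹ * Real.goldenRatio⁻¹ := by positivity
      rw [e, abs_mul, abs_neg, abs_of_pos hpos, pow_succ]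
      have hXi : X⁻¹ ≤ 1 := inv_le_one_of_one_le₀ h1'.le
      refine mul_le_mul hih ?_ hpos.le (by positivity)
      calc X⁻¹ * Real.goldenRatio⁻¹ ≤ 1 * Real.goldenRatio⁻¹ := by gcongr
        _ = _ := one_mul _
  have hlim := tendsto_pow_atTop_nhds_zero_of_lt_one (r := Real.goldenRatio⁻¹) (by positivity)
    (inv_lt_one_of_one_lt₀ hφ1)
  have := ge_of_tendsto' hlim fun m => key m n hn
  exact sub_eq_zero.mp (abs_nonpos_iff.mp this)

theorem tendsto_denominatorQuotient {ξ : ℝ} (hξ : Irrational ξ) {N : ℕ}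
    (h : ∀ n, N ≤ n → completeQuotient ξ n < 2) :
    Tendsto (denominatorQuotient ξ) atTop (𝓝 Real.goldenRatio⁻¹) := by
  have hφ1 := Real.one_lt_goldenRatio
  have hφ2 := Real.goldenRatio_lt_two
  have hφ : Real.goldenRatio = 1 + Real.goldenRatio⁻¹ := by
    rw [inv_goldenRatio_eq_sub_one]
    ring
  have hinv1 : Real.goldenRatio⁻¹ < 1 := inv_lt_one_of_one_lt₀ hφ1
  have hinv0 : 0 < Real.goldenRatio⁻¹ := by positivity
  have key : ∀ m : ℕ,
      |denominatorQuotient ξ (m + N) - Real.goldenRatio⁻¹| ≤ Real.goldenRatio⁻¹ ^ m := by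
    intro m
    induction m with
    | zero =>
      have := denominatorQuotient_mem hξ (0 + N)
      rw [pow_zero, abs_le]
      constructor <;> linarith
    | succ m ih =>
      have hfl : ⌊completeQuotient ξ (m + N)⌋ = 1 := by
        rw [Int.floor_eq_iff]
        constructor
        · exact_mod_cast (one_lt_completeQuotient hξ _).le
        · push_cast; linarith [h (m + N) (by omega)]
      have hη := (denominatorQuotient_mem hξ (m + N)).1
      rw [show m + 1 + N = (m + N) + 1 by ring, denominatorQuotient, hfl]
      generalize denominatorQuotient ξ (m + N) = η at *
      have hη1 : 0 < 1 + η := by linarith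
      have e : ((1 : ℤ) + η)⁻¹ - Real.goldenRatio⁻¹ =
          -(η - Real.goldenRatio⁻¹) * ((1 + η)⁻¹ * Real.goldenRatio⁻¹) := by
        have e1 : η - Real.goldenRatio⁻¹ = (1 + η) - Real.goldenRatio := by linarith
        rw [e1]
        push_cast
        field_simp
        ring
      have hpos : 0 < (1 + η)⁻¹ * Real.goldenRatio⁻¹ := by positivity
      rw [e, abs_mul, abs_neg, abs_of_pos hpos, pow_succ]
      have hXi : (1 + η)⁻¹ ≤ 1 := inv_le_one_of_one_le₀ (by linarith)
      refine mul_le_mul ih ?_ hpos.le (by positivity)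
      calc (1 + η)⁻¹ * Real.goldenRatio⁻¹ ≤ 1 * Real.goldenRatio⁻¹ := by gcongr
        _ = _ := one_mul _
  rw [← tendsto_add_atTop_iff_nat N, tendsto_iff_norm_sub_tendsto_zero]
  exact squeeze_zero (fun _ => norm_nonneg _) key
    (tendsto_pow_atTop_nhds_zero_of_lt_one hinv0.le hinv1)

/-- With the pair (2 + 1/y, 2 - x), the identities 2 + 1/φ = φ² and 2 - φ = 1/φ² make the limit
exactly K; ε is needed because η only converges to 1/φ. -/
theorem eventually_hasApproximant_of_golden {α α' x y K ε ξ : ℝ}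
    (h : HasStandardPairs α α' x y)
    (hK : K * ((Real.goldenRatio + 1 / Real.goldenRatio) * (x * y + 1)) =
      2 * (x - Real.goldenRatio ^ 2) * (1 + y / Real.goldenRatio ^ 2))
    (hε : 0 < ε) (hξ : Irrational ξ) {N : ℕ} (hN : ∀ n, N ≤ n → completeQuotient ξ n < 2) :
    ∀ᶠ n in atTop, HasApproximant α α' (x + y) (completeQuotient ξ n) (denominatorQuotient ξ n)
      (K + ε) := by
  have hx := h.nine_le_left
  have hy := h.nine_le_right
  have hφ1 := Real.one_lt_goldenRatio
  have hφ2 := Real.goldenRatio_lt_two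
  have hsq := Real.goldenRatio_sq
  have hinv := inv_goldenRatio_eq_sub_one
  have hinv2 : y / Real.goldenRatio ^ 2 = (2 - Real.goldenRatio) * y := by
    rw [div_eq_iff (by positivity)]
    have : (2 - Real.goldenRatio) * Real.goldenRatio ^ 2 = 1 := by
      rw [hsq]; linarith
    linear_combination -y * this
  have hxy : 0 < x * y + 1 := by positivity
  have hlim := tendsto_denominatorQuotient hξ hN
  have hcont : Tendsto (fun η : ℝ => 2 * (((2 - Real.goldenRatio) * y + 1) * (x - 2 - η)) -
      (K + ε) * ((Real.goldenRatio + η) * (x * y + 1))) (𝓝 Real.goldenRatio⁻¹)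
      (𝓝 (2 * (((2 - Real.goldenRatio) * y + 1) * (x - 2 - Real.goldenRatio⁻¹)) -
      (K + ε) * ((Real.goldenRatio + Real.goldenRatio⁻¹) * (x * y + 1)))) := by
    apply Continuous.tendsto
    fun_prop
  have hneg : 2 * (((2 - Real.goldenRatio) * y + 1) * (x - 2 - Real.goldenRatio⁻¹)) -
      (K + ε) * ((Real.goldenRatio + Real.goldenRatio⁻¹) * (x * y + 1)) < 0 := by
    have h1 : 0 < ε * ((Real.goldenRatio + Real.goldenRatio⁻¹) * (x * y + 1)) := by positivity
    rw [hinv2, one_div, hsq] at hK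
    have : 2 * (((2 - Real.goldenRatio) * y + 1) * (x - 2 - Real.goldenRatio⁻¹)) =
        2 * (x - (Real.goldenRatio + 1)) * (1 + (2 - Real.goldenRatio) * y) := by
      rw [hinv]; ring
    linarith
  filter_upwards [(hcont.comp hlim).eventually_lt_const hneg, eventually_ge_atTop N] with n hn hNn
  rw [completeQuotient_eq_goldenRatio hξ hN hNn]
  obtain ⟨hη0, hη1⟩ := denominatorQuotient_mem hξ n
  simp only [Function.comp] at hn
  generalize denominatorQuotient ξ n = η at *
  have hp := h.inv_right 2
  push_cast at hp
  have hy1 : 0 < 1 / y := by positivity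
  have hy2 : 1 / y ≤ 1 := by rw [div_le_one (by linarith)]; linarith
  have e1 : |2 - x + η| = x - 2 - η := by rw [abs_of_nonpos (by linarith)]; ring
  have e2 : |(Real.goldenRatio - 2) * y - 1| = (2 - Real.goldenRatio) * y + 1 := by
    rw [abs_of_nonpos (by nlinarith)]; ring
  refine hasApproximant_of_isGLPair (by positivity) (by positivity) ?_ hp (by linarith)
    (by rw [e1]; linarith) ?_
  · rw [abs_of_pos (by positivity)]; linarith
  · rw [e1, e2, mul_comm y x]
    linarith

theorem frequently_hasApproximant {α α' x y K ε ξ : ℝ} (h : HasStandardPairs α α' x y)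
    (hK : K * ((Real.goldenRatio + 1 / Real.goldenRatio) * (x * y + 1)) =
      2 * (x - Real.goldenRatio ^ 2) * (1 + y / Real.goldenRatio ^ 2))
    (hK' : 3416 / 10000 * ((x - 26181 / 10000) * (y + 2618 / 1000)) ≤ K * (x * y + 1))
    (hε : 0 < ε) (hξ : Irrational ξ) :
    ∃ᶠ n in atTop, HasApproximant α α' (x + y) (completeQuotient ξ n) (denominatorQuotient ξ n)
      (K + ε) := by
  have hpos : ∀ n, 0 ≤ completeQuotient ξ n + denominatorQuotient ξ n := fun n =>
    add_nonneg (by linarith [one_lt_completeQuotient hξ n]) (denominatorQuotient_mem hξ n).1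
  by_cases h3 : ∃ᶠ n in atTop, 3 ≤ completeQuotient ξ n
  · refine h3.mono fun n hn => ?_
    exact (h.hasApproximant_of_three_le hK' hn (denominatorQuotient_mem hξ n).1
      (denominatorQuotient_mem hξ n).2).mono (by linarith) (hpos n)
  rw [not_frequently, eventually_atTop] at h3
  obtain ⟨N, hN⟩ := h3
  push Not at hN
  by_cases h2 : ∃ᶠ n in atTop, 2 ≤ completeQuotient ξ n
  · refine (h2.and_eventually (eventually_ge_atTop (N + 1))).mono ?_
    rintro n ⟨hn, hNn⟩
    refine HasApproximant.mono ?_ (by linarith : K ≤ K + ε) (hpos n)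
    obtain ⟨m, rfl⟩ : ∃ m, n = m + 1 := ⟨n - 1, by omega⟩
    have hη := denominatorQuotient_mem hξ m
    have hη1 := (denominatorQuotient_mem hξ (m + 1)).2
    -- The preceding partial quotient is at most 2 and the preceding η at most 1.
    have hη3 : 1 / 3 ≤ denominatorQuotient ξ (m + 1) := by
      have h1 := hN m (by omega)
      have h2 : ⌊completeQuotient ξ m⌋ ≤ 2 := by
        have : ⌊completeQuotient ξ m⌋ < 3 := Int.floor_lt.mpr (by exact_mod_cast h1)
        omega
      have h2' : (⌊completeQuotient ξ m⌋ : ℝ) ≤ 2 := by exact_mod_cast h2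
      have h3 : (1 : ℝ) ≤ ⌊completeQuotient ξ m⌋ := by
        exact_mod_cast one_le_floor_completeQuotient hξ m
      rw [denominatorQuotient, one_div]
      exact inv_anti₀ (by linarith) (by linarith)
    -- Since all later quotients are below 3, fractional parts are at least 1/3 and quotients at
    -- least 4/3; reciprocals then cap fractional parts at 3/4. The interval (7/4, 7/3) is thus
    -- free, which keeps θ away from 1/2.
    have hstep : ∀ k, N ≤ k → 4 / 3 ≤ completeQuotient ξ k ∧
        (completeQuotient ξ k ≤ 7 / 4 ∨ 7 / 3 ≤ completeQuotient ξ k) := by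
      have hfr : ∀ k, N ≤ k → 1 / 3 ≤ Int.fract (completeQuotient ξ k) := by
        intro k hk
        rw [fract_completeQuotient, one_div]
        exact inv_anti₀ (by linarith [one_lt_completeQuotient hξ (k + 1)])
          (hN (k + 1) (by omega)).le
      have h43 : ∀ k, N ≤ k → 4 / 3 ≤ completeQuotient ξ k := by
        intro k hk
        have h1 : (1 : ℝ) ≤ ⌊completeQuotient ξ k⌋ := by
          exact_mod_cast one_le_floor_completeQuotient hξ k
        linarith [hfr k hk, Int.floor_add_fract (completeQuotient ξ k)]
      refine fun k hk => ⟨h43 k hk, ?_⟩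
      have h1 := one_le_floor_completeQuotient hξ k
      have hadd := Int.floor_add_fract (completeQuotient ξ k)
      rcases (by omega : ⌊completeQuotient ξ k⌋ = 1 ∨ 2 ≤ ⌊completeQuotient ξ k⌋) with h | h
      · left
        have hu : Int.fract (completeQuotient ξ k) ≤ 3 / 4 := by
          rw [fract_completeQuotient, show (3 / 4 : ℝ) = (4 / 3)⁻¹ by norm_num]
          exact inv_anti₀ (by norm_num) (h43 (k + 1) (by omega))
        rw [h] at hadd
        push_cast at hadd
        linarith
      · right
        have h' : (2 : ℝ) ≤ ⌊completeQuotient ξ k⌋ := by exact_mod_cast h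
        linarith [hfr k hk]
    have hfl : ⌊completeQuotient ξ (m + 1)⌋ = 2 := by
      rw [Int.floor_eq_iff]
      constructor
      · exact_mod_cast hn
      · push_cast; linarith [hN (m + 1) (by omega)]
    have hadd := Int.floor_add_fract (completeQuotient ξ (m + 1))
    rw [hfl] at hadd
    push_cast at hadd
    have hlt := hN (m + 1 + 1) (by omega)
    have hθ := fract_completeQuotient ξ (m + 1)
    have hθ1 := (Int.fract_lt_one (completeQuotient ξ (m + 1))).le
    rw [← hadd]
    refine h.hasApproximant_of_floor_eq_two hK' hη3 hη1 ?_
    obtain ⟨h43, hor⟩ := hstep (m + 1 + 1) (by omega)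
    rcases hor with h74 | h73
    · right
      refine ⟨?_, hθ1⟩
      rw [hθ, show (4 / 7 : ℝ) = (7 / 4)⁻¹ by norm_num]
      exact inv_anti₀ (by linarith) h74
    · left
      rw [hθ]
      constructor
      · rw [one_div]
        exact inv_anti₀ (by linarith) hlt.le
      · rw [show (3 / 7 : ℝ) = (7 / 3)⁻¹ by norm_num]
        exact inv_anti₀ (by norm_num) h73
  rw [not_frequently, eventually_atTop] at h2
  obtain ⟨M, hM⟩ := h2
  push Not at hM
  exact (eventually_hasApproximant_of_golden h hK hε hξ hM).frequently

/-! ### The standard pairs and the conclusion. -/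

theorem hasStandardPairs_betaCF {u v : ℕ} (hu : 9 ≤ u) (hv : 9 ≤ v) :
    HasStandardPairs (betaCF u v) (-1 / betaCF v u) (betaCF u v) (betaCF v u) := by
  have hu1 : 1 ≤ u := by omega
  have hv1 : 1 ≤ v := by omega
  have hx := betaCF_eq_add_inv hu1 hv1
  have hy := betaCF_eq_add_inv hv1 hu1
  have hx1 := one_le_betaCF hu1 hv1
  have hy1 := one_le_betaCF hv1 hu1
  have hu' : (9 : ℝ) ≤ u := by exact_mod_cast hu
  have hv' : (9 : ℝ) ≤ v := by exact_mod_cast hv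
  generalize betaCF u v = x at *
  generalize betaCF v u = y at *
  have hxi : 0 < 1 / x := by positivity
  have hyi : 0 < 1 / y := by positivity
  -- The maps are k + 1/X, X + k - u and k - 1/X; the second uses x - u = 1/y.
  refine ⟨by linarith, by linarith, fun k => ⟨k, 1, 1, 0, Or.inr (by ring), ?_, ?_⟩,
    fun k => ⟨1, k - u, 0, 1, Or.inl (by ring), ?_, ?_⟩,
    fun k => ⟨k, -1, 1, 0, Or.inl (by ring), ?_, ?_⟩⟩
  · push_cast
    field_simp
    ring
  · push_cast
    field_simp
    ring
  · push_cast
    rw [zero_mul, zero_add, div_one]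
    linarith
  · push_cast
    rw [zero_mul, zero_add, div_one, neg_div]
    linarith
  · push_cast
    field_simp
    ring
  · push_cast
    field_simp
    ring

/-- For `v ≥ u ≥ 9`, the Hurwitz constant of `[u, v, u, v, …]` is given by the explicit formula,
and it is attained at the golden ratio. -/
theorem theorem2 (u v : ℕ) (hu : 9 ≤ u) (huv : u ≤ v) (τ₁ τ₂ K : ℝ)
    (hτ₁ : τ₁ = betaCF u v) (hτ₂ : τ₂ = betaCF v u)
    (hK : K = 2 * (τ₁ - Real.goldenRatio ^ 2) * (1 + τ₂ / Real.goldenRatio ^ 2) /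
      ((Real.goldenRatio + 1 / Real.goldenRatio) * (τ₁ * τ₂ + 1))) :
    IsHurwitzConstant (betaCF u v) K ∧
      approxConst τ₁ Real.goldenRatio = (K : EReal) ∧
      Irrational Real.goldenRatio ∧ Real.goldenRatio ∉ orbitTheta τ₁ := by
  have hu1 : 1 ≤ u := by omega
  have hv1 : 1 ≤ v := by omega
  have hstd := hasStandardPairs_betaCF hu (hu.trans huv)
  have hx := hstd.nine_le_left
  have hy := hstd.nine_le_right
  have hxe := betaCF_eq_add_inv hu1 hv1
  have hye := betaCF_eq_add_inv hv1 hu1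
  have hconj := betaCF_conj_eqs hu1 hv1
  have hα := irrational_betaCF hu1 hv1
  have hα' := irrational_neg_inv_betaCF hu1 hv1
  subst hτ₁ hτ₂
  have hxy : 0 < betaCF u v * betaCF v u + 1 := by positivity
  have hφ1 := Real.one_lt_goldenRatio
  have hφ : Real.goldenRatio = (1 + √5) / 2 := rfl
  have h5 : (0 : ℝ) < √5 := by positivity
  have h55 : √5 ^ 2 = (5 : ℝ) := Real.sq_sqrt (by norm_num)
  have hsq := Real.goldenRatio_sq
  have hinv : 1 / Real.goldenRatio = Real.goldenRatio - 1 := by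
    rw [one_div, inv_goldenRatio_eq_sub_one]
  have hinv2 : betaCF v u / Real.goldenRatio ^ 2 = (2 - Real.goldenRatio) * betaCF v u := by
    rw [div_eq_iff (by positivity)]
    have : (2 - Real.goldenRatio) * Real.goldenRatio ^ 2 = 1 := by
      rw [hsq]; linarith
    linear_combination -betaCF v u * this
  have hKm : K * ((Real.goldenRatio + 1 / Real.goldenRatio) * (betaCF u v * betaCF v u + 1)) =
      2 * (betaCF u v - Real.goldenRatio ^ 2) * (1 + betaCF v u / Real.goldenRatio ^ 2) := by
    rw [hK, div_mul_cancel₀]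
    positivity
  have hKs : K * (√5 * (betaCF u v * betaCF v u + 1)) =
      2 * (betaCF u v - (3 + √5) / 2) * (1 + (3 - √5) / 2 * betaCF v u) := by
    rw [hinv2, hinv, hsq, hφ] at hKm
    linear_combination hKm
  have hK' : 3416 / 10000 * ((betaCF u v - 26181 / 10000) * (betaCF v u + 2618 / 1000)) ≤
      K * (betaCF u v * betaCF v u + 1) := by
    have h5l : 2236 / 1000 ≤ √5 := Real.le_sqrt_of_sq_le (by norm_num)
    have h5u : √5 ≤ 223607 / 100000 := Real.sqrt_le_iff.mpr ⟨by norm_num, by norm_num⟩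
    generalize betaCF u v = x at *
    generalize betaCF v u = y at *
    have e : (3 + √5) / 2 * √5 * (K * (x * y + 1)) =
        2 * ((x - (3 + √5) / 2) * ((3 + √5) / 2 + y)) := by
      linear_combination (3 + √5) / 2 * hKs - (x - (3 + √5) / 2) * y / 2 * h55
    have hc : (3 + √5) / 2 * √5 * (3416 / 10000) ≤ 2 := by nlinarith
    have hc0 : 0 < (3 + √5) / 2 * √5 := by positivity
    have h1 : (x - 26181 / 10000) * (y + 2618 / 1000) ≤
        (x - (3 + √5) / 2) * ((3 + √5) / 2 + y) :=
      mul_le_mul (by linarith) (by linarith) (by linarith) (by linarith)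
    have h0 : 0 ≤ (x - 26181 / 10000) * (y + 2618 / 1000) :=
      mul_nonneg (by linarith) (by linarith)
    refine le_of_mul_le_mul_left ?_ hc0
    rw [e, ← mul_assoc]
    exact mul_le_mul hc h1 h0 (by norm_num)
  have hle : ∀ ξ : ℝ, Irrational ξ → approxConst (betaCF u v) ξ ≤ K := fun ξ hξ =>
    approxConst_le_of_hasApproximant hu1 hv1 (betaCF u v + betaCF v u) hξ fun ε hε =>
      frequently_hasApproximant hstd hKm hK' hε hξ
  have hlt : -1 / betaCF v u < betaCF u v := by
    have : -1 / betaCF v u ≤ 0 := div_nonpos_of_nonpos_of_nonneg (by norm_num) (by linarith)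
    linarith
  -- The formula for K enters here: substituting u = x - 1/y and v = y - 1/x identifies (1+K)T with
  -- the upper end of the gap.
  have hKT : (1 + K) * (√5 * (((v : ℤ) : ℝ) * (betaCF u v - -1 / betaCF v u))) =
      3 * ((u : ℤ) : ℝ) * ((v : ℤ) : ℝ) - 2 * ((v : ℤ) : ℝ) + 2 * ((u : ℤ) : ℝ) := by
    have hu' : (u : ℝ) = betaCF u v - 1 / betaCF v u := by linarith
    have hv' : (v : ℝ) = betaCF v u - 1 / betaCF u v := by linarith
    rw [Int.cast_natCast, Int.cast_natCast, hu', hv']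
    generalize betaCF u v = x at *
    generalize betaCF v u = y at *
    have hx0 : x ≠ 0 := by positivity
    have hy0 : y ≠ 0 := by positivity
    have e : (1 + K) * (√5 * (x * y + 1)) = 3 * (x * y - 1) + 2 * x - 2 * y := by
      linear_combination hKs + y / 2 * h55
    have e1 : (y - 1 / x) * (x - -1 / y) = (x * y + 1) * ((x * y - 1) / (x * y)) := by
      field_simp
      ring
    rw [e1, ← mul_assoc √5, ← mul_assoc, e]
    field_simp
    ring
  have hgold : ∀ β ∈ orbitTheta (betaCF u v), β ≠ galConj β ∧ K * √5 * |β - galConj β| ≤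
      2 * |β - Real.goldenRatio| * |galConj β - Real.goldenConj| := by
    intro β hβ
    obtain ⟨β', hp⟩ := exists_isGLPair_of_mem_orbitTheta hu1 hv1 hβ
    rw [hp.galConj_eq_of_betaCF hu1 hv1]
    constructor
    · obtain ⟨p, q, r, s, hdet, h1, h2⟩ := hp
      rw [← sub_ne_zero, IsGLPair.sub_eq hα hα' hdet h1 h2]
      refine div_ne_zero (mul_ne_zero ?_ (sub_ne_zero.mpr hlt.ne')) (mul_ne_zero
        (mul_add_ne_zero_of_irrational hα (bottom_row_ne_zero hdet))
        (mul_add_ne_zero_of_irrational hα' (bottom_row_ne_zero hdet)))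
      rcases hdet with h | h <;> rw [h] <;> norm_num
    · refine hp.mul_le_golden (u := u) (v := v) (by exact_mod_cast hu) (by exact_mod_cast huv)
        hα hα' hlt ?_ ?_ hKT
      · rw [hconj.1]; norm_cast
      · rw [hconj.2]
        have : (v : ℝ) ≠ 0 := by positivity
        push_cast
        field_simp
  have hKpos : 0 < K := by
    have : 0 < (betaCF u v - 26181 / 10000) * (betaCF v u + 2618 / 1000) :=
      mul_pos (by linarith) (by linarith)
    exact pos_of_mul_pos_left (lt_of_lt_of_le (by positivity) hK') hxy.le
  -- At β = φ the right side of `hgold` vanishes while the left side is positive.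
  have hnot : Real.goldenRatio ∉ orbitTheta (betaCF u v) := by
    intro hmem
    obtain ⟨hne, hle⟩ := hgold _ hmem
    rw [sub_self, abs_zero, mul_zero, zero_mul] at hle
    have : 0 < |Real.goldenRatio - galConj Real.goldenRatio| := abs_pos.mpr (sub_ne_zero.mpr hne)
    have : 0 < K * √5 * |Real.goldenRatio - galConj Real.goldenRatio| := by positivity
    linarith
  have heq : approxConst (betaCF u v) Real.goldenRatio = (K : EReal) :=
    le_antisymm (hle _ Real.goldenRatio_irrational) (le_approxConst_goldenRatio hgold)
  refine ⟨⟨⟨_, Real.goldenRatio_irrational, hnot, heq⟩, ?_⟩, heq, Real.goldenRatio_irrational, hnot⟩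
  rintro c ⟨ξ, hξ, -, rfl⟩
  exact hle ξ hξ
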